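/- All graphs and posets are finite. The cover graph of a poset $P$ is the graph on the elements of $P$ in which two elements are adjacent when one covers the other. In a planar drawing of a graph $G$, the vertices are distinct points of the plane, every edge is a simple arc joining its two ends and passing through no other vertex, and two distinct edges meet only in common ends. A planar drawing of $G$ is called $1$-outerplanar if all vertices of $G$ lie on the exterior face; for $k \ge 2$ it is called $k$-outerplanar if removing all vertices on the exterior face (and the edges incident to them) yields a $(k-1)$-outerplanar drawing of a subgraph of $G$. A graph is $k$-outerplanar if it admits a $k$-outerplanar drawing. For $n \ge 3$, the Kelly poset $K_n$ consists of the following subsets of $[n] = \{1, \ldots, n\}$, ordered by inclusion: $a_i = \{i\}$ and $b_i = [n] \setminus \{i\}$ for $1 \le i \le n$, and $c_i = \{1, \ldots, i\}$ and $d_i = \{i+1, \ldots, n\}$ for $1 \le i \le n-1$. For a poset $P$, let $\kappa(P)$ denote the largest integer $n \ge 3$ such that $P$ contains an induced subposet isomorphic to $K_n$; if there is no such $n$, set $\kappa(P) = 2$. **Lemma.** For every integer $k \ge 1$, if $P$ is a poset with a $k$-outerplanar cover graph, then $$\kappa(P) \le 4k + 2.$$ -/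

import Mathlib

/-- A planar drawing of a simple graph `G`; the plane is `ℂ`. Vertices are drawn as distinct points,
every edge as a Jordan arc (the image of an injective path) joining its two ends, an arc passes
through no other vertex, and two distinct arcs meet only in a common end. The value of `arc` at a
pair that is not an edge is irrelevant. -/
structure PlanarDrawing {V : Type*} (G : SimpleGraph V) where
  pt : V → ℂ
  arc : Sym2 V → Set ℂ
  pt_injective : Function.Injective pt
  arc_eq_range : ∀ u v : V, G.Adj u v →
    ∃ γ : Path (pt u) (pt v), Function.Injective γ ∧ arc s(u, v) = Set.range γ
  mem_of_pt_mem_arc : ∀ e ∈ G.edgeSet, ∀ w : V, pt w ∈ arc e → w ∈ e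
  no_crossing : ∀ e ∈ G.edgeSet, ∀ f ∈ G.edgeSet, e ≠ f →
    ∀ z ∈ arc e ∩ arc f, ∃ w : V, w ∈ e ∧ w ∈ f ∧ z = pt w

namespace PlanarDrawing

variable {V : Type*} {G : SimpleGraph V}

/-- The point set of the induced drawing of the subgraph of `G` induced by `W`: the vertices in `W`
and the edges with both ends in `W`. -/
def support (D : PlanarDrawing G) (W : Set V) : Set ℂ :=
  D.pt '' W ∪ ⋃ e ∈ {e : Sym2 V | e ∈ G.edgeSet ∧ ∀ w ∈ e, w ∈ W}, D.arc e

/-- The exterior face of the induced drawing of `G[W]`: the points of the complement of the drawing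
whose connected component in that complement is unbounded. -/
def exteriorFace (D : PlanarDrawing G) (W : Set V) : Set ℂ :=
  {z | z ∈ (D.support W)ᶜ ∧
    ¬ Bornology.IsBounded (connectedComponentIn (D.support W)ᶜ z)}

/-- The vertices lying on (the boundary of) the exterior face of the induced drawing of `G[W]`. -/
def exteriorVertices (D : PlanarDrawing G) (W : Set V) : Set V :=
  {v | v ∈ W ∧ D.pt v ∈ closure (D.exteriorFace W)}

/-- The induced drawing of `G[W]` is `k`-outerplanar: after `k` times removing all vertices on the
exterior face, with the edges incident to them, no vertex is left. For `k = 1` this says that all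
vertices of `W` lie on the exterior face. -/
def IsOuterplanarOn (D : PlanarDrawing G) : ℕ → Set V → Prop
  | 0, W => W = ∅
  | k + 1, W => IsOuterplanarOn D k (W \ D.exteriorVertices W)

end PlanarDrawing

/-- A graph is `k`-outerplanar if it admits a `k`-outerplanar drawing. -/
def IsKOuterplanar {V : Type*} (k : ℕ) (G : SimpleGraph V) : Prop :=
  ∃ D : PlanarDrawing G, D.IsOuterplanarOn k Set.univ

/-- The subsets `a_i = {i}`, `b_i = [n] \ {i}` for `1 ≤ i ≤ n` and `c_i = {1, …, i}`,
`d_i = {i + 1, …, n}` for `1 ≤ i ≤ n - 1` of `[n] = {1, …, n}`. -/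
def kellyFamily (n : ℕ) : Set (Finset ℕ) :=
  {s | (∃ i, 1 ≤ i ∧ i ≤ n ∧ s = {i}) ∨
    (∃ i, 1 ≤ i ∧ i ≤ n ∧ s = Finset.Icc 1 n \ {i}) ∨
    (∃ i, 1 ≤ i ∧ i + 1 ≤ n ∧ s = Finset.Icc 1 i) ∨
    (∃ i, 1 ≤ i ∧ i + 1 ≤ n ∧ s = Finset.Icc (i + 1) n)}

/-- The Kelly poset: the family above ordered by inclusion. -/
abbrev Kelly (n : ℕ) : Type := {s : Finset ℕ // s ∈ kellyFamily n}

/-- The integers `n ≥ 3` such that `P` contains a subposet isomorphic to the Kelly poset,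
together with the default value `2`. -/
def kappaSet (P : Type*) [PartialOrder P] : Set ℕ :=
  {n | n = 2 ∨ (3 ≤ n ∧ Nonempty (Kelly n ↪o P))}

/-- The largest `n ≥ 3` such that `P` contains a subposet isomorphic to the Kelly poset on `[n]`,
and `2` if there is no such `n`. For finite `P` the supremum is a maximum, see
`isGreatest_kappa`. -/
noncomputable def kappa (P : Type*) [PartialOrder P] : ℕ := sSup (kappaSet P)

theorem isGreatest_kappa (P : Type*) [PartialOrder P] [Finite P] :
    IsGreatest (kappaSet P) (kappa P) := by
  have hne : (kappaSet P).Nonempty := ⟨2, Or.inl rfl⟩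
  have hb : BddAbove (kappaSet P) := by
    refine ⟨Nat.card P + 2, ?_⟩
    rintro n (rfl | ⟨-, ⟨f⟩⟩)
    · omega
    · let g : Fin n → P := fun i => f ⟨{i.1 + 1}, Or.inl ⟨i.1 + 1, by omega, by omega, rfl⟩⟩
      have hg : Function.Injective g := by
        intro i j h
        have h2 := congrArg Subtype.val (f.injective h)
        have h3 : i.1 + 1 = j.1 + 1 := Finset.singleton_injective h2
        exact Fin.ext (by omega)
      have h4 := Nat.card_le_card_of_injective g hg
      rw [Nat.card_fin] at h4
      omega
  exact ⟨Nat.sSup_mem hne hb, fun n hn => le_csSup hb hn⟩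

/-! Suppose `K_n` embeds in `P`. For `4 ≤ i ≤ n - 3` the elements `a_i`, `c_{i-1}`, `d_i` below and
`b_i`, `d_{i-1}`, `c_i` above form a six-element crown. After tightening, saturated chains along its
comparabilities form a cycle of the cover graph. The bound comes from counting these `n - 6` cycles,
using three facts.

Separation (`CrownLink.separates`, `exists_separating_cycle`): in every planar drawing the `i`-th
cycle separates `c_1` from `c_{n-1}`. The rest of the Kelly poset supplies connected sets off the
cycle, attached on the two sides at interlacing places; a connection between `c_1` and `c_{n-1}`
avoiding the cycle would complete a `K₃,₃`. Its nonplanarity is needed with one edge replaced by an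
arbitrary connected plane set, so it is proved topologically (`no_planar_K33`), from the absence of
a continuous square root of `(z - w) / (z - y)` off `{w, y}`.

Freeing (`exists_small_set_freeing`): in a `k`-outerplanar drawing, deleting at most `k` vertices,
the given vertex among them, connects it to infinity. Doing so for `c_1` and `c_{n-1}` connects the
two through infinity, so each cycle contains a deleted vertex. Neither `c_1` nor `c_{n-1}` lies on a
cycle, which leaves at most `2(k - 1)` vertices to hit them all.

Multiplicity (`KellyPosition.false_of_three`): no vertex lies on three of the cycles, since it would
be above some `a_j` and below `b_j`.

Hence `n - 6 ≤ 2 · 2(k - 1)`, that is, `n ≤ 4k + 2`. -/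

section

open Set Metric

/-! ### Square roots of `(z - w) / (z - y)` and a topological `K₃,₃`. -/

theorem exists_log_lift {X : Type*} [TopologicalSpace X] (h : unitInterval → X → ℂ)
    (hc : Continuous (Function.uncurry h)) (h0 : ∀ t x, h t x ≠ 0) (h1 : ∀ x, h 0 x = 1) :
    ∃ φ : X → ℂ, Continuous φ ∧ ∀ x, Complex.exp (φ x) = h 1 x := by
  let H : C(unitInterval × X, {z : ℂ // z ≠ 0}) :=
    ⟨fun p => ⟨h p.1 p.2, h0 _ _⟩, Continuous.subtype_mk hc _⟩
  have H0 : ∀ a, H (0, a) = ⟨_, Complex.exp_ne_zero ((0 : C(X, ℂ)) a)⟩ := fun a =>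
    Subtype.ext ((h1 a).trans Complex.exp_zero.symm)
  refine ⟨fun x => Complex.isCoveringMap_exp.liftHomotopy H 0 H0 (1, x), by fun_prop, fun x => ?_⟩
  exact congrArg Subtype.val (congrFun (Complex.isCoveringMap_exp.liftHomotopy_lifts H 0 H0) (1, x))

/-- Sliding a point from `y` to `w` along a path in `A` deforms the constant `1` into `(z - w) / (z
- y)` without zeros off `A`. A logarithm therefore exists there, and half of it gives the root. -/
theorem exists_sqrt_of_joinedIn {A : Set ℂ} {w y : ℂ} (h : JoinedIn A w y) :
    ∃ ψ : ℂ → ℂ, ContinuousOn ψ Aᶜ ∧ ∀ z ∈ Aᶜ, ψ z ^ 2 = (z - w) / (z - y) := by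
  classical
  obtain ⟨γ, hγ⟩ := h.symm
  have hne : ∀ (t : unitInterval) (z : ↥Aᶜ), (z : ℂ) - γ t ≠ 0 := fun t z hz =>
    z.2 (by rw [sub_eq_zero.1 hz]; exact hγ t)
  have hy : ∀ z : ↥Aᶜ, (z : ℂ) - y ≠ 0 := fun z => by simpa using hne 0 z
  obtain ⟨φ, hφ, hexp⟩ := exists_log_lift
    (fun t (z : ↥Aᶜ) => ((z : ℂ) - γ t) / ((z : ℂ) - y))
    (Continuous.div (by fun_prop) (by fun_prop) fun p => hy p.2)
    (fun t z => div_ne_zero (hne t z) (hy z)) (fun z => by simp [div_self (hy z)])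
  refine ⟨fun z => if hz : z ∈ Aᶜ then Complex.exp (φ ⟨z, hz⟩ / 2) else 0, ?_, ?_⟩
  · rw [continuousOn_iff_continuous_domRestrict]
    have : Continuous fun a : ↥Aᶜ => Complex.exp (φ a / 2) := by fun_prop
    refine this.congr fun a => ?_
    rw [Set.domRestrict_apply, dif_pos a.2]
  · intro z hz
    simp only [dif_pos hz]
    rw [← Complex.exp_nat_mul, show ((2 : ℕ) : ℂ) * (φ ⟨z, hz⟩ / 2) = φ ⟨z, hz⟩ by push_cast; ring,
      hexp]
    simp

/-- Monodromy on the circle about `w` of radius `|w - y| / 2`: the numerator winds once around `0`,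
while the denominator, up to the factor `w - y`, stays in the right half-plane and does not wind. -/
theorem not_exists_sqrt_on_compl_pair {w y : ℂ} (hwy : w ≠ y) :
    ¬ ∃ ψ : ℂ → ℂ, ContinuousOn ψ ({w, y} : Set ℂ)ᶜ ∧
      ∀ z ∈ ({w, y} : Set ℂ)ᶜ, ψ z ^ 2 = (z - w) / (z - y) := by
  rintro ⟨ψ, hc, hs⟩
  set a := w - y with ha
  have ha0 : a ≠ 0 := sub_ne_zero.2 hwy
  let e : ℝ → ℂ := fun t => Complex.exp (t * Complex.I)
  have he : ∀ t, ‖e t‖ = 1 := fun t => Complex.norm_exp_ofReal_mul_I t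
  have he0 : ∀ t, e t ≠ 0 := fun t => Complex.exp_ne_zero _
  let u : ℝ → ℂ := fun t => 1 + (1 / 2) * e t
  have hu : ∀ t, u t ∈ Complex.slitPlane := by
    intro t
    left
    have h1 : |(e t).re| ≤ 1 := (Complex.abs_re_le_norm _).trans (he t).le
    have h2 : (u t).re = 1 + (1 / 2) * (e t).re := by simp [u]
    rw [h2]
    linarith [neg_abs_le (e t).re]
  have hec : Continuous e := by fun_prop
  let p : ℝ → ℂ := fun t => w + a * (1 / 2) * e t
  have hpw : ∀ t, p t - w = a * (1 / 2) * e t := fun t => by simp [p]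
  have hpy : ∀ t, p t - y = a * u t := fun t => by simp [p, u, ha]; ring
  have hu0 : ∀ t, u t ≠ 0 := fun t => Complex.slitPlane_ne_zero (hu t)
  have hp : ∀ t, p t ∈ ({w, y} : Set ℂ)ᶜ := by
    intro t
    simp only [mem_compl_iff, mem_insert_iff, mem_singleton_iff, not_or, ← sub_eq_zero (b := w),
      ← sub_eq_zero (b := y), hpw, hpy]
    have := he0 t
    have := hu0 t
    constructor <;> simp_all
  -- The factors cancel the square root of the denominator and that of `e t`, so `g ^ 2` is the
  -- constant `1 / 2` and `g` is constant. The half-angle factor nevertheless changes sign over a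
  -- full turn.
  let g : ℝ → ℂ := fun t => ψ (p t) * (u t) ^ (1 / 2 : ℂ) * Complex.exp (-(t / 2) * Complex.I)
  have hg : Continuous g := by
    refine Continuous.mul (Continuous.mul ?_ ?_) (by fun_prop)
    · exact hc.comp_continuous (by fun_prop) hp
    · exact Continuous.cpow (by fun_prop) continuous_const hu
  have hg2 : ∀ t, g t ^ 2 = 1 / 2 := by
    intro t
    have h1 : ((u t) ^ (1 / 2 : ℂ)) ^ 2 = u t := by
      rw [← Complex.cpow_mul_nat]; norm_num
    have h2 : Complex.exp (-(t / 2) * Complex.I) ^ 2 = (e t)⁻¹ := by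
      rw [← Complex.exp_nat_mul, ← Complex.exp_neg]
      congr 1
      push_cast
      ring
    simp only [g]
    rw [mul_pow, mul_pow, h1, h2, hs _ (hp t), hpw, hpy]
    field_simp [hu0 t, he0 t]
  have hg0 : g 0 ≠ 0 := fun h => by
    have := hg2 0
    rw [h] at this
    norm_num at this
  have hconst := isPreconnected_univ.eq_of_sq_eq hg.continuousOn
    (continuousOn_const (c := g 0)) (fun t _ => by simp [hg2]) (fun _ => hg0)
    (mem_univ (0 : ℝ)) rfl (mem_univ (2 * Real.pi))
  have hper : e (2 * Real.pi) = e 0 := by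
    simp [e, Complex.exp_two_pi_mul_I]
  have : g (2 * Real.pi) = - g 0 := by
    have h3 : Complex.exp (-((2 * Real.pi : ℝ) / 2) * Complex.I) = -1 := by
      rw [show (-(((2 * Real.pi : ℝ) : ℂ) / 2) * Complex.I) = -(Real.pi * Complex.I) by
        push_cast; ring, Complex.exp_neg, Complex.exp_pi_mul_I]
      norm_num
    simp only [g, p, u, hper, h3]
    simp
  rw [this] at hconst
  exact hg0 (self_eq_neg.1 hconst.symm)

/-- The topological form of the nonplanarity of `K₃,₃`, with one vertex class `w`, `y`, `q`. -/
theorem no_planar_K33 {w y q : ℂ} (hwy : w ≠ y) {A N : Fin 3 → Set ℂ}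
    (hcl : ∀ i, IsClosed (A i)) (hj : ∀ i, JoinedIn (A i) w y)
    (hA : ∀ i j, i ≠ j → A i ∩ A j ⊆ {w, y})
    (hconn : ∀ i, IsPreconnected (A i \ {w, y}))
    (hN : ∀ i, IsPreconnected (N i)) (hq : ∀ i, q ∈ N i)
    (hNA : ∀ i, (N i ∩ (A i \ {w, y})).Nonempty)
    (hNd : ∀ i j, i ≠ j → Disjoint (N i) (A j)) : False := by
  classical
  choose ψ' hc' hs' using fun i => exists_sqrt_of_joinedIn (hj i)
  have hwA : ∀ i, w ∈ A i := fun i => (hj i).source_mem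
  have hyA : ∀ i, y ∈ A i := fun i => (hj i).target_mem
  have hqA : ∀ i, q ∈ (A i)ᶜ := by
    intro i
    obtain ⟨j, hji⟩ := exists_ne i
    exact fun h => disjoint_left.1 (hNd j i hji) (hq j) h
  have hne' : ∀ i, ∀ z ∈ (A i)ᶜ, ψ' i z ≠ 0 := by
    intro i z hz h0
    have h := hs' i z hz
    rw [h0, eq_comm] at h
    rcases div_eq_zero_iff.1 (by simpa using h) with h | h
    · exact hz (sub_eq_zero.1 h ▸ hwA i)
    · exact hz (sub_eq_zero.1 h ▸ hyA i)
  -- normalise the branches at `q`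
  let ψ : Fin 3 → ℂ → ℂ := fun i z => ψ' 0 q / ψ' i q * ψ' i z
  have hψq : ∀ i, ψ i q = ψ' 0 q := fun i => by
    simp only [ψ]; exact div_mul_cancel₀ _ (hne' i q (hqA i))
  have hc : ∀ i, ContinuousOn (ψ i) (A i)ᶜ := fun i => continuousOn_const.mul (hc' i)
  have hs : ∀ i, ∀ z ∈ (A i)ᶜ, ψ i z ^ 2 = (z - w) / (z - y) := by
    intro i z hz
    simp only [ψ]
    have h1 : (ψ' 0 q / ψ' i q) ^ 2 = 1 := by
      rw [div_pow, hs' 0 q (hqA 0), hs' i q (hqA i)]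
      apply div_self
      rw [← hs' i q (hqA i)]
      exact pow_ne_zero _ (hne' i q (hqA i))
    rw [mul_pow, h1, one_mul, hs' i z hz]
  have hne : ∀ i, ∀ z ∈ (A i)ᶜ, ψ i z ≠ 0 := fun i z hz =>
    mul_ne_zero (div_ne_zero (hne' 0 q (hqA 0)) (hne' i q (hqA i))) (hne' i z hz)
  -- Two branches have the same nowhere vanishing square, so on a connected set where both are
  -- defined a single agreement forces agreement throughout.
  have key : ∀ i j (S : Set ℂ), IsPreconnected S → S ⊆ (A i)ᶜ → S ⊆ (A j)ᶜ → ∀ z0 ∈ S,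
      ψ i z0 = ψ j z0 → ∀ z ∈ S, ψ i z = ψ j z := by
    intro i j S hS hi hj z0 hz0 h0 z hz
    exact hS.eq_of_sq_eq ((hc i).mono hi) ((hc j).mono hj)
      (fun z hz => by simp [hs i z (hi hz), hs j z (hj hz)]) (fun hz => hne j _ (hj hz)) hz0 h0 hz
  -- Agreement at `q` travels along `N k` to the arc `A k` and then along that arc; both sets avoid
  -- the cuts of the other two branches.
  have hagree : ∀ k i j, i ≠ k → j ≠ k → ∀ z ∈ A k \ {w, y}, ψ i z = ψ j z := by
    intro k i j hik hjk
    have hsub : ∀ i, i ≠ k → A k \ {w, y} ⊆ (A i)ᶜ := fun i hi z hz hzi =>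
      hz.2 (hA k i hi.symm ⟨hz.1, hzi⟩)
    obtain ⟨p, hpN, hpA⟩ := hNA k
    have hNs : ∀ i, i ≠ k → N k ⊆ (A i)ᶜ := fun i hi =>
      subset_compl_iff_disjoint_right.2 (hNd k i hi.symm)
    exact key i j _ (hconn k) (hsub i hik) (hsub j hjk) p hpA
      (key i j _ (hN k) (hNs i hik) (hNs j hjk) q (hq k) (by rw [hψq, hψq]) p hpN)
  let P : Fin 3 → Fin 3 → Set ℂ := fun i j => {z | z ∈ (A i)ᶜ ∧ z ∈ (A j)ᶜ ∧ ψ i z = ψ j z}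
  have hPo : ∀ i j, IsOpen (P i j) := by
    intro i j
    rw [isOpen_iff_mem_nhds]
    rintro z ⟨hi, hj, hz⟩
    obtain ⟨ε, hε, hb⟩ := Metric.isOpen_iff.1 ((hcl i).isOpen_compl.inter (hcl j).isOpen_compl) z
      ⟨hi, hj⟩
    filter_upwards [ball_mem_nhds z hε] with x hx
    exact ⟨(hb hx).1, (hb hx).2, key i j _ (convex_ball z ε).isPreconnected (fun x hx => (hb hx).1)
      (fun x hx => (hb hx).2) z (mem_ball_self hε) hz x hx⟩
  -- on the complement of `w`, `y` at least two of the three branches are defined and agree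
  have hcov : ∀ z ∈ ({w, y} : Set ℂ)ᶜ, z ∈ P 0 1 ∨ z ∈ P 0 2 ∨ z ∈ P 1 2 := by
    intro z hz
    have hoff : ∀ k i, i ≠ k → z ∈ A k → z ∈ (A i)ᶜ := fun k i hi hk hzi =>
      hz (hA k i hi.symm ⟨hk, hzi⟩)
    by_cases h0 : z ∈ A 0
    · exact .inr (.inr ⟨hoff 0 1 (by decide) h0, hoff 0 2 (by decide) h0,
        hagree 0 1 2 (by decide) (by decide) z ⟨h0, hz⟩⟩)
    by_cases h1 : z ∈ A 1
    · exact .inr (.inl ⟨hoff 1 0 (by decide) h1, hoff 1 2 (by decide) h1,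
        hagree 1 0 2 (by decide) (by decide) z ⟨h1, hz⟩⟩)
    by_cases h2 : z ∈ A 2
    · exact .inl ⟨hoff 2 0 (by decide) h2, hoff 2 1 (by decide) h2,
        hagree 2 0 1 (by decide) (by decide) z ⟨h2, hz⟩⟩
    have e1 : ψ 0 z = ψ 1 z ∨ ψ 0 z = - ψ 1 z :=
      sq_eq_sq_iff_eq_or_eq_neg.1 (by rw [hs 0 z h0, hs 1 z h1])
    have e2 : ψ 0 z = ψ 2 z ∨ ψ 0 z = - ψ 2 z :=
      sq_eq_sq_iff_eq_or_eq_neg.1 (by rw [hs 0 z h0, hs 2 z h2])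
    rcases e1 with e1 | e1
    · exact .inl ⟨h0, h1, e1⟩
    rcases e2 with e2 | e2
    · exact .inr (.inl ⟨h0, h2, e2⟩)
    exact .inr (.inr ⟨h1, h2, neg_injective (e1.symm.trans e2)⟩)
  -- Glue by majority: the value is the one shared by two branches, and any two such pairs have a
  -- branch in common.
  let Φ : ℂ → ℂ := fun z => if z ∈ P 0 1 ∨ z ∈ P 0 2 then ψ 0 z else ψ 1 z
  have hΦ : ∀ z i j, (i = 0 ∧ j = 1 ∨ i = 0 ∧ j = 2 ∨ i = 1 ∧ j = 2) → z ∈ P i j →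
      Φ z = ψ i z := by
    rintro z i j (⟨rfl, rfl⟩ | ⟨rfl, rfl⟩ | ⟨rfl, rfl⟩) hz
    · simp only [Φ, if_pos (Or.inl hz)]
    · simp only [Φ, if_pos (Or.inr hz)]
    · by_cases h : z ∈ P 0 1 ∨ z ∈ P 0 2
      · simp only [Φ, if_pos h]
        rcases h with h | h
        · exact h.2.2
        · exact h.2.2.trans hz.2.2.symm
      · simp only [Φ, if_neg h]
  have hcov' : ∀ z ∈ ({w, y} : Set ℂ)ᶜ, ∃ i j : Fin 3,
      (i = 0 ∧ j = 1 ∨ i = 0 ∧ j = 2 ∨ i = 1 ∧ j = 2) ∧ z ∈ P i j := by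
    intro z hz
    rcases hcov z hz with h | h | h
    · exact ⟨0, 1, by simp, h⟩
    · exact ⟨0, 2, by simp, h⟩
    · exact ⟨1, 2, by simp, h⟩
  refine not_exists_sqrt_on_compl_pair hwy ⟨Φ, ?_, ?_⟩
  · intro z hz
    obtain ⟨i, j, hij, hP⟩ := hcov' z hz
    refine ContinuousAt.continuousWithinAt ?_
    have h1 : ContinuousAt (ψ i) z := (hc i).continuousAt ((hcl i).isOpen_compl.mem_nhds hP.1)
    refine h1.congr ?_
    filter_upwards [(hPo i j).mem_nhds hP] with x hx
    exact (hΦ x i j hij hx).symm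
  · intro z hz
    obtain ⟨i, j, hij, hP⟩ := hcov' z hz
    rw [hΦ z i j hij hP, hs i z hP.1]

theorem isPreconnected_compl_closedBall {R : ℝ} (hR : 0 < R) :
    IsPreconnected (closedBall (0 : ℂ) R)ᶜ := by
  have : (closedBall (0 : ℂ) R)ᶜ = Complex.exp '' {z | Real.log R < z.re} := by
    ext z
    simp only [mem_compl_iff, mem_closedBall, dist_zero_right, not_le, mem_image, mem_ofPred_eq]
    constructor
    · intro hz
      have hz0 : z ≠ 0 := norm_pos_iff.1 (hR.trans hz)
      exact ⟨Complex.log z, by rw [Complex.log_re]; exact Real.log_lt_log hR hz,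
        Complex.exp_log hz0⟩
    · rintro ⟨x, hx, rfl⟩
      rw [Complex.norm_exp]
      exact (Real.log_lt_iff_lt_exp hR).1 hx
  rw [this]
  exact (convex_halfSpace_re_gt _).isPreconnected.image _ Complex.continuous_exp.continuousOn

/-! ### Connected vertex sets. -/

namespace SimpleGraph

variable {V : Type*} (G : SimpleGraph V)

/-- `u` and `v` are joined by a walk of `G` inside `U`. -/
def LinkedIn (U : Set V) : V → V → Prop :=
  Relation.ReflTransGen fun x y => G.Adj x y ∧ x ∈ U ∧ y ∈ U

/-- The vertex set `U` induces a (pre)connected subgraph of `G`. -/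
def IsConnSet (U : Set V) : Prop := ∀ u ∈ U, ∀ v ∈ U, G.LinkedIn U u v

/-- Some vertex of `U` is adjacent to `v`. -/
def Touches (U : Set V) (v : V) : Prop := ∃ u ∈ U, G.Adj u v

variable {G}

theorem LinkedIn.symm {U : Set V} {u v : V} (h : G.LinkedIn U u v) : G.LinkedIn U v u := by
  have : Std.Symm fun x y => G.Adj x y ∧ x ∈ U ∧ y ∈ U := ⟨fun _ _ h => ⟨h.1.symm, h.2.2, h.2.1⟩⟩
  exact Relation.ReflTransGen.stdSymm.symm _ _ h

theorem LinkedIn.trans {U : Set V} {u v w : V} (h : G.LinkedIn U u v) (h' : G.LinkedIn U v w) :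
    G.LinkedIn U u w :=
  Relation.ReflTransGen.trans h h'

theorem LinkedIn.mono {U U' : Set V} (hU : U ⊆ U') {u v : V} (h : G.LinkedIn U u v) :
    G.LinkedIn U' u v :=
  Relation.ReflTransGen.mono (fun _ _ h => ⟨h.1, hU h.2.1, hU h.2.2⟩) _ _ h

theorem LinkedIn.of_adj {U : Set V} {u v : V} (h : G.Adj u v) (hu : u ∈ U) (hv : v ∈ U) :
    G.LinkedIn U u v :=
  Relation.ReflTransGen.single ⟨h, hu, hv⟩

theorem LinkedIn.refl (U : Set V) (u : V) : G.LinkedIn U u u := Relation.ReflTransGen.refl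

theorem IsConnSet.of_root {U : Set V} (r : V) (h : ∀ u ∈ U, G.LinkedIn U u r) : G.IsConnSet U :=
  fun u hu v hv => (h u hu).trans (h v hv).symm

theorem IsConnSet.union {U U' : Set V} (h : G.IsConnSet U) (h' : G.IsConnSet U') {r : V}
    (hr : r ∈ U) (hr' : r ∈ U') : G.IsConnSet (U ∪ U') :=
  .of_root r fun u hu => hu.elim (fun hu => (h u hu r hr).mono subset_union_left)
    fun hu => (h' u hu r hr').mono subset_union_right

theorem Touches.mono {U U' : Set V} (hU : U ⊆ U') {v : V} (h : G.Touches U v) : G.Touches U' v :=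
  let ⟨u, hu, ha⟩ := h; ⟨u, hU hu, ha⟩

end SimpleGraph

/-! ### Point sets of parts of a planar drawing. -/

namespace PlanarDrawing

variable {V : Type*} {G : SimpleGraph V} (D : PlanarDrawing G)

theorem isCompact_arc {e : Sym2 V} (he : e ∈ G.edgeSet) : IsCompact (D.arc e) := by
  induction e with
  | _ u v =>
    obtain ⟨γ, -, hγ⟩ := D.arc_eq_range u v he
    rw [hγ]
    exact isCompact_range γ.continuous

theorem joinedIn_arc {u v : V} (h : G.Adj u v) :
    JoinedIn (D.arc s(u, v)) (D.pt u) (D.pt v) := by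
  obtain ⟨γ, -, hγ⟩ := D.arc_eq_range u v h
  exact ⟨γ, fun t => hγ ▸ mem_range_self t⟩

theorem isPreconnected_arc {u v : V} (h : G.Adj u v) : IsPreconnected (D.arc s(u, v)) := by
  obtain ⟨γ, -, hγ⟩ := D.arc_eq_range u v h
  rw [hγ]
  exact isPreconnected_range γ.continuous

theorem pt_mem_arc {e : Sym2 V} (he : e ∈ G.edgeSet) {v : V} (hv : v ∈ e) :
    D.pt v ∈ D.arc e := by
  obtain ⟨u, rfl⟩ := hv
  exact (D.joinedIn_arc he).source_mem

theorem isPreconnected_arc_diff {u v : V} (h : G.Adj u v) :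
    IsPreconnected (D.arc s(u, v) \ {D.pt v}) := by
  obtain ⟨γ, hinj, hγ⟩ := D.arc_eq_range u v h
  have : D.arc s(u, v) \ {D.pt v} = γ.extend '' Ico 0 1 := by
    rw [hγ]
    ext z
    constructor
    · rintro ⟨⟨t, rfl⟩, ht⟩
      refine ⟨t, ⟨t.2.1, lt_of_le_of_ne t.2.2 fun h1 => ht ?_⟩, by simp⟩
      have : t = 1 := Subtype.ext h1
      simp [this]
    · rintro ⟨t, ht, rfl⟩
      have ht' : t ∈ unitInterval := ⟨ht.1, ht.2.le⟩
      rw [γ.extend_apply ht']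
      refine ⟨mem_range_self _, fun h1 => ?_⟩
      have h2 : γ ⟨t, ht'⟩ = γ 1 := by simpa using h1
      exact ht.2.ne (congrArg Subtype.val (hinj h2))
  rw [this]
  exact isPreconnected_Ico.image _ γ.continuous_extend.continuousOn

/-- The points of the drawing of the vertices in `X` and the edges in `S`. -/
def pts (X : Set V) (S : Set (Sym2 V)) : Set ℂ := D.pt '' X ∪ ⋃ e ∈ S, D.arc e

theorem pts_mono {X X' : Set V} {S S' : Set (Sym2 V)} (hX : X ⊆ X') (hS : S ⊆ S') :
    D.pts X S ⊆ D.pts X' S' :=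
  union_subset_union (image_mono hX) (biUnion_subset_biUnion_left hS)

theorem support_mono {W W' : Set V} (h : W ⊆ W') : D.support W ⊆ D.support W' :=
  D.pts_mono h fun _ he => ⟨he.1, fun w hw => h (he.2 w hw)⟩

theorem pt_mem_support {W : Set V} {v : V} (hv : v ∈ W) : D.pt v ∈ D.support W :=
  .inl (mem_image_of_mem _ hv)

theorem arc_subset_support {W : Set V} {u v : V} (h : G.Adj u v) (hu : u ∈ W) (hv : v ∈ W) :
    D.arc s(u, v) ⊆ D.support W := by
  refine subset_union_of_subset_right (subset_biUnion_of_mem (u := D.arc) (x := s(u, v)) ?_) _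
  refine ⟨h, fun w hw => ?_⟩
  rcases Sym2.mem_iff.1 hw with rfl | rfl <;> assumption

theorem isCompact_pts [Finite V] {X : Set V} {S : Set (Sym2 V)} (hS : S ⊆ G.edgeSet) :
    IsCompact (D.pts X S) :=
  ((toFinite X).image _).isCompact.union
    ((toFinite S).isCompact_biUnion fun _ he => D.isCompact_arc (hS he))

theorem isCompact_support [Finite V] (W : Set V) : IsCompact (D.support W) :=
  D.isCompact_pts fun _ he => he.1

/-- This is where the absence of crossings enters: parts of the drawing with no common edge can meet
only in drawn vertices belonging to both. -/
theorem exists_pt_of_mem_pts_inter {X X' : Set V} {S S' : Set (Sym2 V)} (hS : S ⊆ G.edgeSet)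
    (hS' : S' ⊆ G.edgeSet) (hd : ∀ e ∈ S, e ∉ S') {z : ℂ} (hz : z ∈ D.pts X S)
    (hz' : z ∈ D.pts X' S') :
    ∃ v, z = D.pt v ∧ (v ∈ X ∨ ∃ e ∈ S, v ∈ e) ∧ (v ∈ X' ∨ ∃ e ∈ S', v ∈ e) := by
  simp only [pts, mem_union, mem_image, mem_iUnion, exists_prop] at hz hz'
  rcases hz with ⟨v, hv, rfl⟩ | ⟨e, he, hze⟩
  · refine ⟨v, rfl, .inl hv, ?_⟩
    rcases hz' with ⟨v', hv', h⟩ | ⟨e', he', hze'⟩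
    · exact .inl (D.pt_injective h ▸ hv')
    · exact .inr ⟨e', he', D.mem_of_pt_mem_arc _ (hS' he') _ hze'⟩
  · rcases hz' with ⟨v', hv', rfl⟩ | ⟨e', he', hze'⟩
    · exact ⟨v', rfl, .inr ⟨e, he, D.mem_of_pt_mem_arc _ (hS he) _ hze⟩, .inl hv'⟩
    · obtain ⟨v, hv, hv', h⟩ := D.no_crossing e (hS he) e' (hS' he')
        (fun h => hd e he (h ▸ he')) z ⟨hze, hze'⟩
      exact ⟨v, h, .inr ⟨e, he, hv⟩, .inr ⟨e', he', hv'⟩⟩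

theorem disjoint_pts {X X' : Set V} {S S' : Set (Sym2 V)} (hS : S ⊆ G.edgeSet)
    (hS' : S' ⊆ G.edgeSet) (hd : ∀ v, (v ∈ X ∨ ∃ e ∈ S, v ∈ e) → (v ∈ X' ∨ ∃ e ∈ S', v ∈ e) → False) :
    Disjoint (D.pts X S) (D.pts X' S') := by
  refine disjoint_left.2 fun z hz hz' => ?_
  obtain ⟨v, -, h, h'⟩ := D.exists_pt_of_mem_pts_inter hS hS' (fun e he he' =>
    hd (Quot.out e).1 (.inr ⟨e, he, Sym2.out_fst_mem e⟩) (.inr ⟨e, he', Sym2.out_fst_mem e⟩)) hz hz'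
  exact hd v h h'

theorem support_vertex {W : Set V} {v : V} (h : v ∈ W ∨ ∃ e ∈ {e | e ∈ G.edgeSet ∧ ∀ w ∈ e, w ∈ W},
    v ∈ e) : v ∈ W :=
  h.elim id fun ⟨_, he, hv⟩ => he.2 v hv

theorem pt_mem_support_iff {W : Set V} {v : V} : D.pt v ∈ D.support W ↔ v ∈ W := by
  refine ⟨fun h => ?_, D.pt_mem_support⟩
  rcases h with ⟨v', hv', h⟩ | h
  · exact D.pt_injective h ▸ hv'
  · simp only [mem_iUnion] at h
    obtain ⟨e, he, hv⟩ := h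
    exact he.2 v (D.mem_of_pt_mem_arc e he.1 v hv)

theorem disjoint_support {W W' : Set V} (h : Disjoint W W') :
    Disjoint (D.support W) (D.support W') :=
  D.disjoint_pts (fun _ he => he.1) (fun _ he => he.1) fun _ hv hv' =>
    disjoint_left.1 h (support_vertex hv) (support_vertex hv')

theorem joinedIn_support {U : Set V} {u v : V} (hu : u ∈ U) (h : G.LinkedIn U u v) :
    JoinedIn (D.support U) (D.pt u) (D.pt v) := by
  induction h with
  | refl => exact .refl (D.pt_mem_support hu)
  | tail _ h ih =>
    exact ih.trans ((D.joinedIn_arc h.1).mono (D.arc_subset_support h.1 h.2.1 h.2.2))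

theorem isPreconnected_support {U : Set V} (h : G.IsConnSet U) : IsPreconnected (D.support U) := by
  refine isPreconnected_of_forall_pair ?_
  have key : ∀ z ∈ D.support U, ∃ u ∈ U, ∃ t ⊆ D.support U, z ∈ t ∧ D.pt u ∈ t ∧
      IsPreconnected t := by
    rintro z (⟨u, hu, rfl⟩ | hz)
    · exact ⟨u, hu, {D.pt u}, by simpa using D.pt_mem_support hu, rfl, rfl,
        isPreconnected_singleton⟩
    · simp only [mem_iUnion] at hz
      obtain ⟨e, he, hz⟩ := hz
      induction e with
      | _ u v =>
        exact ⟨u, he.2 u (by simp), D.arc s(u, v),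
          D.arc_subset_support he.1 (he.2 u (by simp)) (he.2 v (by simp)), hz,
          D.pt_mem_arc he.1 (by simp), D.isPreconnected_arc he.1⟩
  intro x hx y hy
  obtain ⟨u, hu, t, ht, hxt, hut, htc⟩ := key x hx
  obtain ⟨v, hv, s, hs, hys, hvs, hsc⟩ := key y hy
  obtain ⟨γ, hγ⟩ := D.joinedIn_support hu (h u hu v hv)
  refine ⟨t ∪ range γ ∪ s, union_subset (union_subset ht (range_subset_iff.2 hγ)) hs,
    .inl (.inl hxt), .inr hys, ?_⟩
  exact IsPreconnected.union (D.pt v) (.inr ⟨1, γ.target⟩) hvs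
    (htc.union (D.pt u) hut ⟨0, γ.source⟩ (isPreconnected_range γ.continuous)) hsc

end PlanarDrawing

/-! ### Outerplanar layers: reaching infinity at the cost of few vertices. -/

namespace PlanarDrawing

variable {V : Type*} {G : SimpleGraph V} (D : PlanarDrawing G)

theorem exists_support_subset_closedBall [Finite V] :
    ∃ R : ℝ, 0 < R ∧ ∀ W, D.support W ⊆ closedBall 0 R := by
  obtain ⟨R, hR⟩ := (D.isCompact_support univ).isBounded.subset_closedBall 0
  exact ⟨max R 1, by positivity, fun W => (D.support_mono (subset_univ W)).trans
    (hR.trans (closedBall_subset_closedBall (le_max_left _ _)))⟩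

theorem compl_closedBall_subset_exteriorFace {R : ℝ} (hR : 0 < R)
    (hb : ∀ W, D.support W ⊆ closedBall 0 R) (W : Set V) :
    (closedBall 0 R)ᶜ ⊆ D.exteriorFace W := by
  intro z hz
  have hsub : (closedBall (0 : ℂ) R)ᶜ ⊆ (D.support W)ᶜ := compl_subset_compl.2 (hb W)
  refine ⟨hsub hz, fun hbd => ?_⟩
  have h1 := hbd.subset
    ((isPreconnected_compl_closedBall hR).subset_connectedComponentIn hz hsub)
  have h2 : Bornology.IsBounded (univ : Set ℂ) := by
    rw [← union_compl_self (closedBall (0 : ℂ) R)]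
    exact isBounded_closedBall.union h1
  exact NormedSpace.unbounded_univ ℝ ℂ h2

/-- Every unbounded component of the complement meets the outside of the ball, which is connected
and misses the drawing. -/
theorem isPreconnected_exteriorFace {R : ℝ} (hR : 0 < R)
    (hb : ∀ W, D.support W ⊆ closedBall 0 R) (W : Set V) :
    IsPreconnected (D.exteriorFace W) := by
  have hN := D.compl_closedBall_subset_exteriorFace hR hb W
  obtain ⟨x0, hx0⟩ : ((closedBall (0 : ℂ) R)ᶜ).Nonempty := by
    by_contra h
    rw [not_nonempty_iff_eq_empty, compl_empty_iff] at h
    exact NormedSpace.unbounded_univ ℝ ℂ (h ▸ isBounded_closedBall)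
  refine isPreconnected_of_forall x0 fun z hz => ?_
  have hmeet : (connectedComponentIn (D.support W)ᶜ z ∩ (closedBall 0 R)ᶜ).Nonempty := by
    by_contra h
    rw [not_nonempty_iff_eq_empty, ← disjoint_iff_inter_eq_empty,
      disjoint_compl_right_iff_subset] at h
    exact hz.2 (isBounded_closedBall.subset h)
  refine ⟨connectedComponentIn (D.support W)ᶜ z ∪ (closedBall 0 R)ᶜ, union_subset ?_ hN,
    .inr hx0, .inl (mem_connectedComponentIn hz.1),
    isPreconnected_connectedComponentIn.union' hmeet (isPreconnected_compl_closedBall hR)⟩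
  intro x hx
  refine ⟨connectedComponentIn_subset _ _ hx, ?_⟩
  rw [← connectedComponentIn_eq hx]
  exact hz.2

theorem exists_mem_frontier_of_isPreconnected {E F : Set ℂ} (hE : IsPreconnected E) (hF : IsOpen F)
    (h : (E ∩ F).Nonempty) (h' : (E \ F).Nonempty) : ∃ z ∈ E, z ∈ closure F ∧ z ∉ F := by
  by_contra! hcon
  obtain ⟨x, hx⟩ := h
  obtain ⟨y, hy⟩ := h'
  obtain ⟨z, -, hz, hz'⟩ := hE F (closure F)ᶜ hF isClosed_closure.isOpen_compl
    (fun z hz => by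
      by_cases hc : z ∈ closure F
      · exact .inl (hcon z hz hc)
      · exact .inr hc) ⟨x, hx⟩ ⟨y, hy.1, fun hc => hy.2 (hcon y hy.1 hc)⟩
  exact hz' (subset_closure hz)

/-- In a `k`-outerplanar drawing every vertex can be freed by the removal of at most `k` vertices:
it is then connected to infinity in the complement of the drawing. -/
theorem exists_small_set_freeing [Finite V] {R : ℝ} (hR : 0 < R)
    (hb : ∀ W, D.support W ⊆ closedBall 0 R) (k : ℕ) :
    ∀ W : Set V, D.IsOuterplanarOn k W → ∀ p ∈ W, ∃ H : Finset V, p ∈ H ∧ H.card ≤ k ∧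
      ∃ E : Set ℂ, IsPreconnected E ∧ (closedBall 0 R)ᶜ ⊆ E ∧ D.pt p ∈ E ∧
        Disjoint E (D.support (W \ H)) := by
  classical
  induction k with
  | zero =>
    intro W hW p hp
    rw [IsOuterplanarOn] at hW
    simp [hW] at hp
  | succ k ih =>
    intro W hW p hp
    have hext : ∀ u ∈ D.exteriorVertices W,
        IsPreconnected (D.exteriorFace W ∪ {D.pt u}) ∧
        ∀ H : Set V, u ∈ H → Disjoint (D.exteriorFace W ∪ {D.pt u}) (D.support (W \ H)) := by
      intro u hu
      constructor
      · refine (D.isPreconnected_exteriorFace hR hb W).subset_closure subset_union_left ?_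
        exact union_subset subset_closure (singleton_subset_iff.2 hu.2)
      · intro H hH
        refine Disjoint.union_left ?_ ?_
        · refine disjoint_left.2 fun z hz hz' => hz.1 (D.support_mono sdiff_subset hz')
        · rw [disjoint_singleton_left, D.pt_mem_support_iff]
          exact fun h => h.2 hH
    have hN := D.compl_closedBall_subset_exteriorFace hR hb W
    by_cases hpe : p ∈ D.exteriorVertices W
    · refine ⟨{p}, by simp, by simp, D.exteriorFace W ∪ {D.pt p}, (hext p hpe).1,
        hN.trans subset_union_left, .inr rfl, (hext p hpe).2 _ (by simp)⟩
    -- With the outer layer peeled off, induction frees `p` by `k` vertices; the set `E` may still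
    -- cross the outer layer. One further vertex will compensate for that.
    obtain ⟨H, hpH, hHk, E, hE, hNE, hpE, hEd⟩ := ih _ hW p ⟨hp, hpe⟩
    set F := connectedComponentIn (D.support (W \ H))ᶜ (D.pt p) with hFdef
    have hpt : D.pt p ∈ (D.support (W \ H))ᶜ := by
      rw [mem_compl_iff, D.pt_mem_support_iff]
      exact fun h => h.2 hpH
    have hpF : D.pt p ∈ F := mem_connectedComponentIn hpt
    have hFs : Disjoint F (D.support (W \ H)) :=
      subset_compl_iff_disjoint_right.1 (connectedComponentIn_subset _ _)
    have hFc : IsPreconnected F := isPreconnected_connectedComponentIn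
    by_cases hmeet : (F ∩ (closedBall 0 R)ᶜ).Nonempty
    · refine ⟨H, hpH, hHk.trans (Nat.le_succ k), F ∪ (closedBall 0 R)ᶜ,
        hFc.union' hmeet (isPreconnected_compl_closedBall hR), subset_union_right, .inl hpF, ?_⟩
      refine Disjoint.union_left hFs ?_
      exact (disjoint_compl_left_iff_subset.2 (hb _))
    have hFo : IsOpen F := (D.isCompact_support _).isClosed.isOpen_compl.connectedComponentIn
    obtain ⟨x0, hx0⟩ : ((closedBall (0 : ℂ) R)ᶜ).Nonempty := by
      by_contra h
      rw [not_nonempty_iff_eq_empty, compl_empty_iff] at h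
      exact NormedSpace.unbounded_univ ℝ ℂ (h ▸ isBounded_closedBall)
    -- `E` leaves the bounded face `F` of `p` at a point `z` of the drawing. As `E` avoids the inner
    -- layers, `z` is an outer vertex or lies on an edge with an outer end; deleting that vertex
    -- opens a passage from `F` to the exterior face.
    obtain ⟨z, hzE, hzc, hzF⟩ := exists_mem_frontier_of_isPreconnected hE hFo ⟨_, hpE, hpF⟩
      ⟨x0, hNE hx0, fun h => hmeet ⟨x0, h, hx0⟩⟩
    have hFz : IsPreconnected (F ∪ {z}) := hFc.subset_closure subset_union_left
      (union_subset subset_closure (singleton_subset_iff.2 hzc))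
    have hzs : z ∈ D.support (W \ H) := by
      by_contra hzs
      refine hzF (hFz.subset_connectedComponentIn (.inl hpF) ?_ (.inr rfl))
      exact union_subset (connectedComponentIn_subset _ _) (singleton_subset_iff.2 hzs)
    have hzs' : z ∉ D.support ((W \ D.exteriorVertices W) \ H) := disjoint_left.1 hEd hzE
    -- a connected set from `z` to a vertex `u` on the exterior face, off the rest of the drawing
    obtain ⟨u, hu, T, hT, hzT, huT, hTd⟩ : ∃ u ∈ D.exteriorVertices W, ∃ T : Set ℂ,
        IsPreconnected T ∧ z ∈ T ∧ D.pt u ∈ T ∧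
        Disjoint T (D.support (W \ ((insert u H : Finset V) : Set V))) := by
      by_cases hv : ∃ v, z = D.pt v
      · obtain ⟨v, rfl⟩ := hv
        rw [D.pt_mem_support_iff] at hzs hzs'
        refine ⟨v, by_contra fun h => hzs' ⟨⟨hzs.1, h⟩, hzs.2⟩, {D.pt v},
          isPreconnected_singleton, rfl, rfl, ?_⟩
        rw [disjoint_singleton_left, D.pt_mem_support_iff]
        exact fun h => h.2 (by simp)
      · rcases hzs with ⟨v, -, rfl⟩ | hz
        · exact absurd ⟨v, rfl⟩ hv
        simp only [mem_iUnion] at hz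
        obtain ⟨e, he, hze⟩ := hz
        obtain ⟨u, hue, hu⟩ : ∃ u ∈ e, u ∈ D.exteriorVertices W := by
          by_contra! hcon
          refine hzs' (.inr ?_)
          simp only [mem_iUnion]
          exact ⟨e, ⟨he.1, fun w hw => ⟨⟨(he.2 w hw).1, hcon w hw⟩, (he.2 w hw).2⟩⟩, hze⟩
        obtain ⟨v, rfl⟩ := hue
        have huv : G.Adj u v := he.1
        refine ⟨u, hu, D.arc s(u, v) \ {D.pt v}, D.isPreconnected_arc_diff huv,
          ⟨hze, fun h => hv ⟨v, h⟩⟩, ⟨D.pt_mem_arc he.1 (by simp), fun h =>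
            huv.ne (D.pt_injective h)⟩, disjoint_left.2 ?_⟩
        rintro x ⟨hx, hxv⟩ hxs
        have hx' : x ∈ D.pts ∅ {s(u, v)} := .inr (by simpa using hx)
        obtain ⟨y, rfl, h1, h2⟩ := D.exists_pt_of_mem_pts_inter (by simpa using huv)
          (fun _ h => h.1) (by
            rintro e rfl h
            exact (h.2 u (by simp)).2 (by simp)) hx' hxs
        have h2 := support_vertex h2
        have h1 : y = u ∨ y = v := by simpa using h1
        rcases h1 with rfl | rfl
        · exact h2.2 (by simp)
        · exact hxv rfl
    refine ⟨insert u H, by simp [hpH], (Finset.card_insert_le _ _).trans (by omega),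
      (F ∪ {z}) ∪ T ∪ (D.exteriorFace W ∪ {D.pt u}), ?_, ?_, .inl (.inl (.inl hpF)), ?_⟩
    · exact IsPreconnected.union (D.pt u) (.inr huT) (.inr rfl)
        (IsPreconnected.union z (.inr rfl) hzT hFz hT) (hext u hu).1
    · exact fun x hx => .inr (.inl (hN hx))
    · refine Disjoint.union_left (Disjoint.union_left (Disjoint.union_left ?_ ?_) hTd) ?_
      · refine hFs.mono_right (D.support_mono (sdiff_subset_sdiff_right ?_))
        simp
      · exact disjoint_singleton_left.2 (disjoint_left.1 hTd hzT)
      · exact (hext u hu).2 _ (by simp)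

/-! ### Planar `K₃,₃` minors. -/

/-- The drawing of the vertices in `U`, the edges inside `U` and the edges from `U` to `w`, `y`. -/
def star (U : Set V) (w y : V) : Set ℂ :=
  D.pts U {e | e ∈ G.edgeSet ∧ (∃ u ∈ e, u ∈ U) ∧ ∀ v ∈ e, v ∈ U ∨ v = w ∨ v = y}

theorem star_subset_support {U W : Set V} {w y : V} (hU : U ⊆ W) (hw : w ∈ W) (hy : y ∈ W) :
    D.star U w y ⊆ D.support W :=
  D.pts_mono hU fun _ he => ⟨he.1, fun v hv => by
    rcases he.2.2 v hv with h | rfl | rfl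
    exacts [hU h, hw, hy]⟩

theorem support_subset_star (U : Set V) (w y : V) : D.support U ⊆ D.star U w y :=
  D.pts_mono subset_rfl fun e he => ⟨he.1, ⟨(Quot.out e).1, Sym2.out_fst_mem e,
    he.2 _ (Sym2.out_fst_mem e)⟩, fun v hv => .inl (he.2 v hv)⟩

theorem star_comm (U : Set V) (w y : V) : D.star U w y = D.star U y w := by
  simp only [star, or_comm]

theorem arc_subset_star {U : Set V} {u w y : V} (h : G.Adj u w) (hu : u ∈ U) :
    D.arc s(u, w) ⊆ D.star U w y := by
  refine subset_union_of_subset_right (subset_biUnion_of_mem (u := D.arc) (x := s(u, w)) ?_) _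
  refine ⟨h, ⟨u, by simp, hu⟩, fun v hv => ?_⟩
  rcases Sym2.mem_iff.1 hv with rfl | rfl
  exacts [.inl hu, .inr (.inl rfl)]

theorem star_vertex {U : Set V} {w y v : V}
    (h : v ∈ U ∨ ∃ e ∈ {e | e ∈ G.edgeSet ∧ (∃ u ∈ e, u ∈ U) ∧ ∀ v ∈ e, v ∈ U ∨ v = w ∨ v = y},
      v ∈ e) : v ∈ U ∨ v = w ∨ v = y :=
  h.elim .inl fun ⟨_, he, hv⟩ => he.2.2 v hv

/-- An edge from `U` to `w` or `y` stays attached to the connected drawing of `U` when its outer end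
is removed. -/
theorem isPreconnected_star_diff {U : Set V} {w y : V} (hU : G.IsConnSet U) (hw : w ∉ U)
    (hy : y ∉ U) : IsPreconnected (D.star U w y \ {D.pt w, D.pt y}) := by
  have hsub : D.support U ⊆ D.star U w y \ {D.pt w, D.pt y} := by
    refine subset_sdiff.2 ⟨D.support_subset_star U w y, disjoint_right.2 ?_⟩
    rintro z (rfl | rfl) <;> rwa [D.pt_mem_support_iff]
  have key : ∀ z ∈ D.star U w y \ {D.pt w, D.pt y}, ∃ u ∈ U,
      ∃ t ⊆ D.star U w y \ {D.pt w, D.pt y}, z ∈ t ∧ D.pt u ∈ t ∧ IsPreconnected t := by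
    rintro z ⟨⟨u, hu, rfl⟩ | hz, hzn⟩
    · exact ⟨u, hu, D.support U, hsub, D.pt_mem_support hu, D.pt_mem_support hu,
        D.isPreconnected_support hU⟩
    · simp only [mem_iUnion] at hz
      obtain ⟨e, ⟨he, ⟨u, hue, hu⟩, hv⟩, hz⟩ := hz
      obtain ⟨v, rfl⟩ := hue
      have hadj : G.Adj u v := he
      by_cases hvU : v ∈ U
      · exact ⟨u, hu, D.support U, hsub, D.arc_subset_support he hu hvU hz, D.pt_mem_support hu,
          D.isPreconnected_support hU⟩
      · have hvwy : v = w ∨ v = y := (hv v (by simp)).resolve_left hvU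
        have hzv : z ≠ D.pt v := by
          rintro rfl
          rcases hvwy with rfl | rfl <;> simp at hzn
        refine ⟨u, hu, D.arc s(u, v) \ {D.pt v}, ?_, ⟨hz, hzv⟩,
          ⟨D.pt_mem_arc he (by simp), fun h => hadj.ne (D.pt_injective h)⟩,
          D.isPreconnected_arc_diff hadj⟩
        rintro x ⟨hx, hxv⟩
        refine ⟨?_, ?_⟩
        · rcases hvwy with rfl | rfl
          · exact D.arc_subset_star hadj hu hx
          · rw [star_comm]
            exact D.arc_subset_star hadj hu hx
        · have aux : ∀ s, s ∉ U → x ≠ D.pt s := by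
            rintro s hs rfl
            rcases Sym2.mem_iff.1 (D.mem_of_pt_mem_arc _ he _ hx) with rfl | rfl
            · exact hs hu
            · exact hxv rfl
          rintro (h | h)
          exacts [aux w hw h, aux y hy h]
  refine isPreconnected_of_forall_pair fun a ha b hb => ?_
  obtain ⟨u, hu, t, ht, hat, hut, htc⟩ := key a ha
  obtain ⟨v, hv, s, hs, hbs, hvs, hsc⟩ := key b hb
  refine ⟨t ∪ D.support U ∪ s, union_subset (union_subset ht hsub) hs, .inl (.inl hat), .inr hbs,
    ?_⟩
  exact IsPreconnected.union (D.pt v) (.inr (D.pt_mem_support hv)) hvs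
    (IsPreconnected.union (D.pt u) hut (D.pt_mem_support hu) htc (D.isPreconnected_support hU)) hsc

theorem joinedIn_star {U : Set V} {w y : V} (hU : G.IsConnSet U) (hw : G.Touches U w)
    (hy : G.Touches U y) : JoinedIn (D.star U w y) (D.pt w) (D.pt y) := by
  obtain ⟨u, hu, huw⟩ := hw
  obtain ⟨v, hv, hvy⟩ := hy
  have h1 := (D.joinedIn_arc huw).symm.mono (D.arc_subset_star (y := y) huw hu)
  have h2 := (D.joinedIn_support hu (hU u hu v hv)).mono (D.support_subset_star U w y)
  have h3 := (D.joinedIn_arc hvy).mono (D.arc_subset_star (y := w) hvy hv)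
  rw [star_comm] at h3
  exact (h1.trans h2).trans h3

/-- Nonplanarity of `K₃,₃`, with two vertices `w`, `y` and four connected sets of vertices as
branch sets, where one edge of the `K₃,₃` is a connected set `E` in the plane. -/
theorem no_planar_K33_minor [Finite V] {w y : V} (hwy : w ≠ y) {U₁ U₂ U₃ Q : Set V}
    (hw : w ∉ U₁ ∧ w ∉ U₂ ∧ w ∉ U₃ ∧ w ∉ Q) (hy : y ∉ U₁ ∧ y ∉ U₂ ∧ y ∉ U₃ ∧ y ∉ Q)
    (h12 : Disjoint U₁ U₂) (h13 : Disjoint U₁ U₃) (h23 : Disjoint U₂ U₃)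
    (hQ1 : Disjoint Q U₁) (hQ2 : Disjoint Q U₂) (hQ3 : Disjoint Q U₃)
    (hU₁ : G.IsConnSet U₁) (hU₂ : G.IsConnSet U₂) (hU₃ : G.IsConnSet U₃) (hQ : G.IsConnSet Q)
    (hw1 : G.Touches U₁ w) (hw2 : G.Touches U₂ w) (hw3 : G.Touches U₃ w)
    (hy1 : G.Touches U₁ y) (hy2 : G.Touches U₂ y) (hy3 : G.Touches U₃ y)
    (hx2 : ∃ x ∈ U₂, G.Touches Q x) (hx3 : ∃ x ∈ U₃, G.Touches Q x)
    {E : Set ℂ} (hE : IsPreconnected E) (hEd : Disjoint E (D.support (U₂ ∪ U₃ ∪ {w, y})))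
    {p q : V} (hp : p ∈ U₁) (hq : q ∈ Q) (hpE : D.pt p ∈ E) (hqE : D.pt q ∈ E) : False := by
  have hstar : ∀ U ⊆ U₂ ∪ U₃ ∪ {w, y}, Disjoint E (D.star U w y) := fun U hU =>
    hEd.mono_right (D.star_subset_support hU (by simp) (by simp))
  have hE2 := hstar U₂ (fun x hx => .inl (.inl hx))
  have hE3 := hstar U₃ (fun x hx => .inl (.inr hx))
  have hcl : ∀ U, IsClosed (D.star U w y) := fun U => (D.isCompact_pts fun _ he => he.1).isClosed
  have hinter : ∀ {U U'}, Disjoint U U' → w ∉ U → y ∉ U → w ∉ U' → y ∉ U' →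
      D.star U w y ∩ D.star U' w y ⊆ {D.pt w, D.pt y} := by
    rintro U U' hd hwU hyU hwU' hyU' z ⟨hz, hz'⟩
    obtain ⟨v, rfl, h1, h2⟩ := D.exists_pt_of_mem_pts_inter (fun _ he => he.1)
      (fun _ he => he.1) (by
        rintro e ⟨-, ⟨u, hue, hu⟩, -⟩ ⟨-, -, h⟩
        rcases h u hue with h | rfl | rfl
        exacts [disjoint_left.1 hd hu h, hwU hu, hyU hu]) hz hz'
    rcases star_vertex h1 with h1 | rfl | rfl
    · rcases star_vertex h2 with h2 | rfl | rfl
      exacts [(disjoint_left.1 hd h1 h2).elim, .inl rfl, .inr rfl]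
    exacts [.inl rfl, .inr rfl]
  -- the drawing of `Q` together with an edge to a vertex `x`
  have hN : ∀ x, G.Touches Q x → ∃ N, IsPreconnected N ∧ D.pt q ∈ N ∧ D.pt x ∈ N ∧
      ∀ U, Disjoint Q U → x ∉ U → x ≠ w → x ≠ y → Disjoint N (D.star U w y) := by
    rintro x ⟨u, hu, hux⟩
    refine ⟨D.pts Q ({e | e ∈ G.edgeSet ∧ ∀ v ∈ e, v ∈ Q} ∪ {s(u, x)}), ?_,
      .inl ⟨q, hq, rfl⟩, ?_, ?_⟩
    · have : D.pts Q ({e | e ∈ G.edgeSet ∧ ∀ v ∈ e, v ∈ Q} ∪ {s(u, x)}) =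
          D.support Q ∪ D.arc s(u, x) := by
        simp only [pts, support, biUnion_union, biUnion_singleton, union_assoc]
      rw [this]
      exact IsPreconnected.union (D.pt u) (D.pt_mem_support hu) (D.pt_mem_arc hux (by simp))
        (D.isPreconnected_support hQ) (D.isPreconnected_arc hux)
    · refine .inr (mem_biUnion (.inr rfl) (D.pt_mem_arc hux (by simp)))
    · intro U hd hxU hxw hxy
      refine D.disjoint_pts ?_ (fun _ he => he.1) ?_
      · rintro e (he | rfl)
        exacts [he.1, hux]
      · intro v h1 h2
        have h1 : v ∈ Q ∨ v = x := by
          rcases h1 with h | ⟨e, he | rfl, hv⟩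
          · exact .inl h
          · exact .inl (he.2 v hv)
          · rcases Sym2.mem_iff.1 hv with rfl | rfl
            exacts [.inl hu, .inr rfl]
        rcases star_vertex h2 with h2 | rfl | rfl
        · rcases h1 with h1 | rfl
          exacts [disjoint_left.1 hd h1 h2, hxU h2]
        · rcases h1 with h1 | rfl
          exacts [hw.2.2.2 h1, hxw rfl]
        · rcases h1 with h1 | rfl
          exacts [hy.2.2.2 h1, hxy rfl]
  obtain ⟨x2, hx2, hx2t⟩ := hx2
  obtain ⟨x3, hx3, hx3t⟩ := hx3
  obtain ⟨N2, hN2, hqN2, hxN2, hN2d⟩ := hN x2 hx2t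
  obtain ⟨N3, hN3, hqN3, hxN3, hN3d⟩ := hN x3 hx3t
  have hmem : ∀ {U x}, x ∈ U → w ∉ U → y ∉ U → D.pt x ∈ D.star U w y \ {D.pt w, D.pt y} := by
    intro U x hx hwU hyU
    refine ⟨.inl ⟨x, hx, rfl⟩, ?_⟩
    rintro (h | h)
    · exact hwU (D.pt_injective h ▸ hx)
    · exact hyU (D.pt_injective h ▸ hx)
  have i12 := hinter h12 hw.1 hy.1 hw.2.1 hy.2.1
  have i13 := hinter h13 hw.1 hy.1 hw.2.2.1 hy.2.2.1
  have i23 := hinter h23 hw.2.1 hy.2.1 hw.2.2.1 hy.2.2.1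
  have d21 := hN2d U₁ hQ1 (disjoint_right.1 h12 hx2) (fun h => hw.2.1 (h ▸ hx2))
    (fun h => hy.2.1 (h ▸ hx2))
  have d23 := hN2d U₃ hQ3 (disjoint_left.1 h23 hx2) (fun h => hw.2.1 (h ▸ hx2))
    (fun h => hy.2.1 (h ▸ hx2))
  have d31 := hN3d U₁ hQ1 (disjoint_right.1 h13 hx3) (fun h => hw.2.2.1 (h ▸ hx3))
    (fun h => hy.2.2.1 (h ▸ hx3))
  have d32 := hN3d U₂ hQ2 (disjoint_right.1 h23 hx3) (fun h => hw.2.2.1 (h ▸ hx3))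
    (fun h => hy.2.2.1 (h ▸ hx3))
  refine no_planar_K33 (w := D.pt w) (y := D.pt y) (q := D.pt q)
    (fun h => hwy (D.pt_injective h)) (A := ![D.star U₁ w y, D.star U₂ w y, D.star U₃ w y])
    (N := ![E, N2, N3]) ?_ ?_ ?_ ?_ ?_ ?_ ?_ ?_
  · intro i; fin_cases i <;> exact hcl _
  · intro i; fin_cases i
    exacts [D.joinedIn_star hU₁ hw1 hy1, D.joinedIn_star hU₂ hw2 hy2, D.joinedIn_star hU₃ hw3 hy3]
  · intro i j hij
    fin_cases i <;> fin_cases j <;> first | exact absurd rfl hij | skip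
    exacts [i12, i13, inter_comm _ _ ▸ i12, i23, inter_comm _ _ ▸ i13, inter_comm _ _ ▸ i23]
  · intro i; fin_cases i
    exacts [D.isPreconnected_star_diff hU₁ hw.1 hy.1, D.isPreconnected_star_diff hU₂ hw.2.1 hy.2.1,
      D.isPreconnected_star_diff hU₃ hw.2.2.1 hy.2.2.1]
  · intro i; fin_cases i
    exacts [hE, hN2, hN3]
  · intro i; fin_cases i
    exacts [hqE, hqN2, hqN3]
  · intro i; fin_cases i
    exacts [⟨_, hpE, hmem hp hw.1 hy.1⟩, ⟨_, hxN2, hmem hx2 hw.2.1 hy.2.1⟩,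
      ⟨_, hxN3, hmem hx3 hw.2.2.1 hy.2.2.1⟩]
  · intro i j hij
    fin_cases i <;> fin_cases j <;> first | exact absurd rfl hij | skip
    exacts [hE2, hE3, d21, d23, d31, d32]

end PlanarDrawing

end

/-! ### Saturated chains and the cycle of a tight crown. -/

section

open Set

/-- `Q` is a saturated chain from `u` to `v`. -/
structure IsSatChain {P : Type*} [PartialOrder P] (u v : P) (Q : Set P) : Prop where
  left_mem : u ∈ Q
  right_mem : v ∈ Q
  le_left : ∀ x ∈ Q, u ≤ x
  le_right : ∀ x ∈ Q, x ≤ v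
  total : ∀ x ∈ Q, ∀ y ∈ Q, x ≤ y ∨ y ≤ x
  up : ∀ x ∈ Q, x ≠ v → ∃ x' ∈ Q, x ⋖ x'
  down : ∀ x ∈ Q, x ≠ u → ∃ x' ∈ Q, x' ⋖ x

namespace IsSatChain

variable {P : Type*} [PartialOrder P]

theorem dual {u v : P} {Q : Set P} (h : IsSatChain u v Q) : IsSatChain (P := Pᵒᵈ) v u Q where
  left_mem := h.right_mem
  right_mem := h.left_mem
  le_left := h.le_right
  le_right := h.le_left
  total x hx y hy := h.total y hy x hx
  up x hx hn := let ⟨x', hx', hc⟩ := h.down x hx hn; ⟨x', hx', hc.toDual⟩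
  down x hx hn := let ⟨x', hx', hc⟩ := h.up x hx hn; ⟨x', hx', hc.toDual⟩

theorem touches_right {u v : P} {Q S : Set P} (h : IsSatChain u v Q) (huv : u ≠ v) (hS : Q \ {v} ⊆ S) :
    (SimpleGraph.hasse P).Touches S v := by
  obtain ⟨x, hx, hc⟩ := h.down v h.right_mem huv.symm
  exact ⟨x, hS ⟨hx, hc.lt.ne⟩, .inl hc⟩

theorem touches_left {u v : P} {Q S : Set P} (h : IsSatChain u v Q) (huv : u ≠ v) (hS : Q \ {u} ⊆ S) :
    (SimpleGraph.hasse P).Touches S u := by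
  obtain ⟨x, hx, hc⟩ := h.up u h.left_mem huv
  exact ⟨x, hS ⟨hx, hc.lt.ne'⟩, .inr hc⟩

theorem exists_of_le [Finite P] {u v : P} (h : u ≤ v) : ∃ Q, IsSatChain u v Q := by
  induction u using WellFoundedGT.induction with
  | _ u ih =>
    rcases h.eq_or_lt with rfl | hlt
    · exact ⟨{u}, rfl, rfl, by simp, by simp, by simp, by simp, by simp⟩
    obtain ⟨u', hc, hu'⟩ := exists_covBy_le_of_lt hlt
    obtain ⟨Q, hQ⟩ := ih u' hc.lt hu'
    refine ⟨insert u Q, by simp, by simp [hQ.right_mem], ?_, ?_, ?_, ?_, ?_⟩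
    · rintro x (rfl | hx)
      exacts [le_rfl, hc.le.trans (hQ.le_left x hx)]
    · rintro x (rfl | hx)
      exacts [h, hQ.le_right x hx]
    · rintro x (rfl | hx) y (rfl | hy)
      exacts [.inl le_rfl, .inl (hc.le.trans (hQ.le_left y hy)),
        .inr (hc.le.trans (hQ.le_left x hx)), hQ.total x hx y hy]
    · rintro x (rfl | hx) hn
      · exact ⟨u', .inr hQ.left_mem, hc⟩
      · obtain ⟨x', hx', h'⟩ := hQ.up x hx hn
        exact ⟨x', .inr hx', h'⟩
    · rintro x (rfl | hx) hn
      · exact absurd rfl hn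
      · by_cases hxu : x = u'
        · exact ⟨u, .inl rfl, hxu ▸ hc⟩
        · obtain ⟨x', hx', h'⟩ := hQ.down x hx hxu
          exact ⟨x', .inr hx', h'⟩

variable [Finite P] {u v : P} {Q S : Set P}

theorem linkedIn_right (h : IsSatChain u v Q) {x : P} (hx : x ∈ Q) :
    (∀ y ∈ Q, x ≤ y → y ∈ S) → (SimpleGraph.hasse P).LinkedIn S x v := by
  induction x using WellFoundedGT.induction with
  | _ x ih =>
    intro hS
    by_cases hxv : x = v
    · rw [hxv]; exact .refl _ _
    obtain ⟨x', hx', hc⟩ := h.up x hx hxv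
    exact .trans (.of_adj (.inl hc) (hS x hx le_rfl) (hS x' hx' hc.le))
      (ih x' hc.lt hx' fun y hy hxy => hS y hy (hc.le.trans hxy))

theorem linkedIn_left (h : IsSatChain u v Q) {x : P} (hx : x ∈ Q) :
    (∀ y ∈ Q, y ≤ x → y ∈ S) → (SimpleGraph.hasse P).LinkedIn S x u := by
  induction x using WellFoundedLT.induction with
  | _ x ih =>
    intro hS
    by_cases hxv : x = u
    · rw [hxv]; exact .refl _ _
    obtain ⟨x', hx', hc⟩ := h.down x hx hxv
    exact .trans (.of_adj (.inr hc) (hS x hx le_rfl) (hS x' hx' hc.le))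
      (ih x' hc.lt hx' fun y hy hxy => hS y hy (hxy.trans hc.le))

theorem isConnSet (h : IsSatChain u v Q) : (SimpleGraph.hasse P).IsConnSet Q :=
  .of_root v fun _ hx => h.linkedIn_right hx fun _ hy _ => hy

theorem isConnSet_diff_right (h : IsSatChain u v Q) :
    (SimpleGraph.hasse P).IsConnSet (Q \ {v}) :=
  .of_root u fun x hx => h.linkedIn_left hx.1 fun y hy hyx => ⟨hy, by
    rintro rfl
    exact hx.2 (le_antisymm (h.le_right x hx.1) hyx)⟩

theorem isConnSet_diff_left (h : IsSatChain u v Q) :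
    (SimpleGraph.hasse P).IsConnSet (Q \ {u}) :=
  .of_root v fun x hx => h.linkedIn_right hx.1 fun y hy hyx => ⟨hy, by
    rintro rfl
    exact hx.2 (le_antisymm hyx (h.le_left x hx.1))⟩

theorem isConnSet_lt (h : IsSatChain u v Q) (z : P) :
    (SimpleGraph.hasse P).IsConnSet {x ∈ Q | x < z} :=
  .of_root u fun _ hx => h.linkedIn_left hx.1 fun _ hy hyx => ⟨hy, hyx.trans_lt hx.2⟩

theorem isConnSet_gt (h : IsSatChain u v Q) (z : P) :
    (SimpleGraph.hasse P).IsConnSet {x ∈ Q | z < x} :=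
  .of_root v fun _ hx => h.linkedIn_right hx.1 fun _ hy hyx => ⟨hy, hx.2.trans_le hyx⟩

end IsSatChain

/-- A tight six-element crown, with saturated chains along its six comparabilities. -/
structure CrownCycle (P : Type*) [PartialOrder P] where
  (A C₀ D₀ B D₁ C₁ : P)
  (QAC QAD QCC QCB QDD QDB : Set P)
  hAC : IsSatChain A C₁ QAC
  hAD : IsSatChain A D₁ QAD
  hCC : IsSatChain C₀ C₁ QCC
  hCB : IsSatChain C₀ B QCB
  hDD : IsSatChain D₀ D₁ QDD
  hDB : IsSatChain D₀ B QDB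
  not_AB : ¬ A ≤ B
  not_CD : ¬ C₀ ≤ D₁
  not_DC : ¬ D₀ ≤ C₁
  tight_A : ∀ x, A ≤ x → x ≤ C₁ → x ≤ D₁ → x = A
  tight_C₀ : ∀ x, C₀ ≤ x → x ≤ C₁ → x ≤ B → x = C₀
  tight_D₀ : ∀ x, D₀ ≤ x → x ≤ D₁ → x ≤ B → x = D₀
  tight_B : ∀ x, x ≤ B → C₀ ≤ x → D₀ ≤ x → x = B
  tight_D₁ : ∀ x, x ≤ D₁ → A ≤ x → D₀ ≤ x → x = D₁
  tight_C₁ : ∀ x, x ≤ C₁ → A ≤ x → C₀ ≤ x → x = C₁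

namespace CrownCycle

variable {P : Type*} [PartialOrder P]

/-- The vertex set of the cycle. -/
def Z (K : CrownCycle P) : Set P := K.QAC ∪ K.QAD ∪ K.QCC ∪ K.QCB ∪ K.QDD ∪ K.QDB

/-- Reversing the order exchanges the roles of `C₀` and `C₁`, and of `D₀` and `D₁`, so facts about
the part of the poset attached at `C₀`, `D₁` also serve the part attached at `C₁`, `D₀`. -/
def dual (K : CrownCycle P) : CrownCycle Pᵒᵈ where
  A := K.B
  C₀ := K.C₁
  D₀ := K.D₁
  B := K.A
  D₁ := K.D₀
  C₁ := K.C₀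
  QAC := K.QCB
  QAD := K.QDB
  QCC := K.QCC
  QCB := K.QAC
  QDD := K.QDD
  QDB := K.QAD
  hAC := K.hCB.dual
  hAD := K.hDB.dual
  hCC := K.hCC.dual
  hCB := K.hAC.dual
  hDD := K.hDD.dual
  hDB := K.hAD.dual
  not_AB := K.not_AB
  not_CD := K.not_DC
  not_DC := K.not_CD
  tight_A x h1 h2 h3 := K.tight_B x h1 h2 h3
  tight_C₀ x h1 h2 h3 := K.tight_C₁ x h1 h3 h2
  tight_D₀ x h1 h2 h3 := K.tight_D₁ x h1 h3 h2
  tight_B x h1 h2 h3 := K.tight_A x h1 h2 h3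
  tight_D₁ x h1 h2 h3 := K.tight_D₀ x h1 h3 h2
  tight_C₁ x h1 h2 h3 := K.tight_C₀ x h1 h3 h2

theorem dual_Z (K : CrownCycle P) : @Eq (Set P) K.dual.Z K.Z := by
  have h : @Eq (Set P) (K.QCB ∪ K.QDB ∪ K.QCC ∪ K.QAC ∪ K.QDD ∪ K.QAD)
      (K.QAC ∪ K.QAD ∪ K.QCC ∪ K.QCB ∪ K.QDD ∪ K.QDB) := by
    ext x
    simp only [mem_union]
    tauto
  exact h

theorem exists_of_le [Finite P] {a c₀ d₀ b d₁ c₁ : P} (hac : a ≤ c₁) (had : a ≤ d₁) (hcc : c₀ ≤ c₁)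
    (hcb : c₀ ≤ b) (hdd : d₀ ≤ d₁) (hdb : d₀ ≤ b) (hab : ¬ a ≤ b) (hcd : ¬ c₀ ≤ d₁)
    (hdc : ¬ d₀ ≤ c₁) : ∃ K : CrownCycle P, a ≤ K.A ∧ c₀ ≤ K.C₀ ∧ d₀ ≤ K.D₀ ∧ K.B ≤ b ∧
      K.D₁ ≤ d₁ ∧ K.C₁ ≤ c₁ := by
  -- The last three coordinates carry the reversed order, so a maximal tuple has its lower elements
  -- pushed up and its upper elements pushed down as far as the comparabilities allow; maximality is
  -- tightness.
  let S : Set (P × P × P × Pᵒᵈ × Pᵒᵈ × Pᵒᵈ) := {p | p.1 ≤ OrderDual.ofDual p.2.2.2.2.2 ∧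
    p.1 ≤ OrderDual.ofDual p.2.2.2.2.1 ∧ p.2.1 ≤ OrderDual.ofDual p.2.2.2.2.2 ∧
    p.2.1 ≤ OrderDual.ofDual p.2.2.2.1 ∧ p.2.2.1 ≤ OrderDual.ofDual p.2.2.2.2.1 ∧
    p.2.2.1 ≤ OrderDual.ofDual p.2.2.2.1}
  obtain ⟨⟨A, C₀, D₀, B, D₁, C₁⟩, hle, hmax⟩ := (toFinite S).exists_le_maximal
    (a := (a, c₀, d₀, OrderDual.toDual b, OrderDual.toDual d₁, OrderDual.toDual c₁))
    ⟨hac, had, hcc, hcb, hdd, hdb⟩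
  obtain ⟨hA, hC₀, hD₀, hB, hD₁, hC₁⟩ := hle
  obtain ⟨⟨h1, h2, h3, h4, h5, h6⟩, hm⟩ := hmax
  induction B using OrderDual.rec with | _ B
  induction D₁ using OrderDual.rec with | _ D₁
  induction C₁ using OrderDual.rec with | _ C₁
  change B ≤ b at hB
  change D₁ ≤ d₁ at hD₁
  change C₁ ≤ c₁ at hC₁
  change a ≤ A at hA
  change c₀ ≤ C₀ at hC₀
  change d₀ ≤ D₀ at hD₀
  simp only [OrderDual.ofDual_toDual] at h1 h2 h3 h4 h5 h6
  obtain ⟨QAC, hQAC⟩ := IsSatChain.exists_of_le h1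
  obtain ⟨QAD, hQAD⟩ := IsSatChain.exists_of_le h2
  obtain ⟨QCC, hQCC⟩ := IsSatChain.exists_of_le h3
  obtain ⟨QCB, hQCB⟩ := IsSatChain.exists_of_le h4
  obtain ⟨QDD, hQDD⟩ := IsSatChain.exists_of_le h5
  obtain ⟨QDB, hQDB⟩ := IsSatChain.exists_of_le h6
  refine ⟨⟨A, C₀, D₀, B, D₁, C₁, QAC, QAD, QCC, QCB, QDD, QDB, hQAC, hQAD, hQCC, hQCB, hQDD, hQDB,
    fun h => hab (hA.trans (h.trans hB)), fun h => hcd (hC₀.trans (h.trans hD₁)),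
    fun h => hdc (hD₀.trans (h.trans hC₁)), ?_, ?_, ?_, ?_, ?_, ?_⟩, hA, hC₀, hD₀, hB, hD₁, hC₁⟩
  · intro x hx k1 k2
    have := hm (y := (x, C₀, D₀, OrderDual.toDual B, OrderDual.toDual D₁, OrderDual.toDual C₁))
      ⟨k1, k2, h3, h4, h5, h6⟩ ⟨hx, le_rfl, le_rfl, le_rfl, le_rfl, le_rfl⟩
    exact le_antisymm this.1 hx
  · intro x hx k1 k2
    have := hm (y := (A, x, D₀, OrderDual.toDual B, OrderDual.toDual D₁, OrderDual.toDual C₁))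
      ⟨h1, h2, k1, k2, h5, h6⟩ ⟨le_rfl, hx, le_rfl, le_rfl, le_rfl, le_rfl⟩
    exact le_antisymm this.2.1 hx
  · intro x hx k1 k2
    have := hm (y := (A, C₀, x, OrderDual.toDual B, OrderDual.toDual D₁, OrderDual.toDual C₁))
      ⟨h1, h2, h3, h4, k1, k2⟩ ⟨le_rfl, le_rfl, hx, le_rfl, le_rfl, le_rfl⟩
    exact le_antisymm this.2.2.1 hx
  · intro x hx k1 k2
    have := hm (y := (A, C₀, D₀, OrderDual.toDual x, OrderDual.toDual D₁, OrderDual.toDual C₁))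
      ⟨h1, h2, h3, k1, h5, k2⟩ ⟨le_rfl, le_rfl, le_rfl, hx, le_rfl, le_rfl⟩
    exact le_antisymm hx this.2.2.2.1
  · intro x hx k1 k2
    have := hm (y := (A, C₀, D₀, OrderDual.toDual B, OrderDual.toDual x, OrderDual.toDual C₁))
      ⟨h1, k1, h3, h4, k2, h6⟩ ⟨le_rfl, le_rfl, le_rfl, le_rfl, hx, le_rfl⟩
    exact le_antisymm hx this.2.2.2.2.1
  · intro x hx k1 k2
    have := hm (y := (A, C₀, D₀, OrderDual.toDual B, OrderDual.toDual D₁, OrderDual.toDual x))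
      ⟨k1, h2, k2, h4, h5, h6⟩ ⟨le_rfl, le_rfl, le_rfl, le_rfl, le_rfl, hx⟩
    exact le_antisymm hx this.2.2.2.2.2

end CrownCycle

namespace CrownCycle

variable {P : Type*} [PartialOrder P] (K : CrownCycle P)

theorem not_A_B {x : P} (h : K.A ≤ x) : ¬ x ≤ K.B := fun h' => K.not_AB (h.trans h')
theorem not_C₀_D₁ {x : P} (h : K.C₀ ≤ x) : ¬ x ≤ K.D₁ := fun h' => K.not_CD (h.trans h')
theorem not_D₀_C₁ {x : P} (h : K.D₀ ≤ x) : ¬ x ≤ K.C₁ := fun h' => K.not_DC (h.trans h')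

theorem A_le_C₁ : K.A ≤ K.C₁ := K.hAC.le_left _ K.hAC.right_mem
theorem A_le_D₁ : K.A ≤ K.D₁ := K.hAD.le_left _ K.hAD.right_mem
theorem C₀_le_C₁ : K.C₀ ≤ K.C₁ := K.hCC.le_left _ K.hCC.right_mem
theorem C₀_le_B : K.C₀ ≤ K.B := K.hCB.le_left _ K.hCB.right_mem
theorem D₀_le_D₁ : K.D₀ ≤ K.D₁ := K.hDD.le_left _ K.hDD.right_mem
theorem D₀_le_B : K.D₀ ≤ K.B := K.hDB.le_left _ K.hDB.right_mem

/-- The order constraints satisfied by the vertices on the six chains. -/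
theorem bounds (x : P) :
    (x ∈ K.QAC → K.A ≤ x ∧ x ≤ K.C₁) ∧ (x ∈ K.QAD → K.A ≤ x ∧ x ≤ K.D₁) ∧
    (x ∈ K.QCC → K.C₀ ≤ x ∧ x ≤ K.C₁) ∧ (x ∈ K.QCB → K.C₀ ≤ x ∧ x ≤ K.B) ∧
    (x ∈ K.QDD → K.D₀ ≤ x ∧ x ≤ K.D₁) ∧ (x ∈ K.QDB → K.D₀ ≤ x ∧ x ≤ K.B) :=
  ⟨fun h => ⟨K.hAC.le_left x h, K.hAC.le_right x h⟩, fun h => ⟨K.hAD.le_left x h, K.hAD.le_right x h⟩,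
    fun h => ⟨K.hCC.le_left x h, K.hCC.le_right x h⟩, fun h => ⟨K.hCB.le_left x h, K.hCB.le_right x h⟩,
    fun h => ⟨K.hDD.le_left x h, K.hDD.le_right x h⟩, fun h => ⟨K.hDB.le_left x h, K.hDB.le_right x h⟩⟩

/-- Together with `bounds` this reduces the question of which chains can share a given vertex to a
propositional one, left to `grind`. -/
theorem constraints (x : P) :
    ¬ (K.A ≤ x ∧ x ≤ K.B) ∧ ¬ (K.C₀ ≤ x ∧ x ≤ K.D₁) ∧ ¬ (K.D₀ ≤ x ∧ x ≤ K.C₁) ∧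
    (K.A ≤ x ∧ x ≤ K.C₁ ∧ x ≤ K.D₁ → x = K.A) ∧ (K.C₀ ≤ x ∧ x ≤ K.C₁ ∧ x ≤ K.B → x = K.C₀) ∧
    (K.D₀ ≤ x ∧ x ≤ K.D₁ ∧ x ≤ K.B → x = K.D₀) ∧ (x ≤ K.B ∧ K.C₀ ≤ x ∧ K.D₀ ≤ x → x = K.B) ∧
    (x ≤ K.D₁ ∧ K.A ≤ x ∧ K.D₀ ≤ x → x = K.D₁) ∧ (x ≤ K.C₁ ∧ K.A ≤ x ∧ K.C₀ ≤ x → x = K.C₁) :=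
  ⟨fun h => K.not_A_B h.1 h.2, fun h => K.not_C₀_D₁ h.1 h.2, fun h => K.not_D₀_C₁ h.1 h.2,
    fun h => K.tight_A x h.1 h.2.1 h.2.2, fun h => K.tight_C₀ x h.1 h.2.1 h.2.2,
    fun h => K.tight_D₀ x h.1 h.2.1 h.2.2, fun h => K.tight_B x h.1 h.2.1 h.2.2,
    fun h => K.tight_D₁ x h.1 h.2.1 h.2.2, fun h => K.tight_C₁ x h.1 h.2.1 h.2.2⟩

/-- `U₂` and `U₃` are the two open arcs into which `w` and `y` divide the cycle. -/
structure Splits (w y : P) (U₂ U₃ : Set P) : Prop where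
  ne : w ≠ y
  conn₂ : (SimpleGraph.hasse P).IsConnSet U₂
  conn₃ : (SimpleGraph.hasse P).IsConnSet U₃
  disj : ∀ x ∈ U₂, x ∉ U₃
  w₂ : w ∉ U₂
  w₃ : w ∉ U₃
  y₂ : y ∉ U₂
  y₃ : y ∉ U₃
  tw₂ : (SimpleGraph.hasse P).Touches U₂ w
  tw₃ : (SimpleGraph.hasse P).Touches U₃ w
  ty₂ : (SimpleGraph.hasse P).Touches U₂ y
  ty₃ : (SimpleGraph.hasse P).Touches U₃ y
  sub : U₂ ∪ U₃ ∪ {w, y} ⊆ K.Z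

theorem corners_ne : K.A ≠ K.C₁ ∧ K.A ≠ K.D₁ ∧ K.C₀ ≠ K.C₁ ∧ K.C₀ ≠ K.B ∧ K.D₀ ≠ K.D₁ ∧
    K.D₀ ≠ K.B ∧ K.C₁ ≠ K.D₀ := by
  have := K.constraints K.A
  have := K.constraints K.C₀
  have := K.constraints K.D₀
  have := K.A_le_C₁
  have := K.A_le_D₁
  have := K.C₀_le_C₁
  have := K.C₀_le_B
  have := K.D₀_le_D₁
  have := K.D₀_le_B
  refine ⟨?_, ?_, ?_, ?_, ?_, ?_, ?_⟩ <;> grind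

variable [Finite P]

/-- The cyclic order of the corners is `C₁`, `A`, `D₁`, `D₀`, `B`, `C₀`. Here `C₁` and `D₀` are
opposite, and the arcs run through `A`, `D₁` and through `C₀`, `B`. -/
theorem exists_splits_D₀ : ∃ U₂ U₃, K.Splits K.C₁ K.D₀ U₂ U₃ ∧ K.QAC \ {K.C₁} ⊆ U₂ ∧ K.D₁ ∈ U₂ ∧
    K.C₀ ∈ U₃ ∧ K.QDB \ {K.D₀} ⊆ U₃ := by
  obtain ⟨n1, n2, n3, n4, n5, n6, n7⟩ := K.corners_ne
  refine ⟨(K.QAC \ {K.C₁}) ∪ K.QAD ∪ (K.QDD \ {K.D₀}), (K.QCC \ {K.C₁}) ∪ K.QCB ∪ (K.QDB \ {K.D₀}),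
    ⟨n7, ?_, ?_, ?_, ?_, ?_, ?_, ?_, ?_, ?_, ?_, ?_, ?_⟩, ?_, ?_, ?_, ?_⟩
  · exact (K.hAC.isConnSet_diff_right.union K.hAD.isConnSet ⟨K.hAC.left_mem, n1⟩
      K.hAD.left_mem).union K.hDD.isConnSet_diff_left (.inr K.hAD.right_mem)
      ⟨K.hDD.right_mem, n5.symm⟩
  · exact (K.hCC.isConnSet_diff_right.union K.hCB.isConnSet ⟨K.hCC.left_mem, n3⟩
      K.hCB.left_mem).union K.hDB.isConnSet_diff_left (.inr K.hCB.right_mem)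
      ⟨K.hDB.right_mem, n6.symm⟩
  · intro x hx hx'
    have := K.bounds x
    have := K.constraints x
    simp only [mem_union, mem_sdiff, mem_singleton_iff] at hx hx'
    grind
  · intro hx
    have := K.bounds K.C₁
    have := K.constraints K.C₁
    simp only [mem_union, mem_sdiff, mem_singleton_iff] at hx
    grind
  · intro hx
    have := K.bounds K.C₁
    have := K.constraints K.C₁
    have := K.C₀_le_C₁
    simp only [mem_union, mem_sdiff, mem_singleton_iff] at hx
    grind
  · intro hx
    have := K.bounds K.D₀
    have := K.constraints K.D₀
    have := K.D₀_le_B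
    simp only [mem_union, mem_sdiff, mem_singleton_iff] at hx
    grind
  · intro hx
    have := K.bounds K.D₀
    have := K.constraints K.D₀
    have := K.D₀_le_D₁
    simp only [mem_union, mem_sdiff, mem_singleton_iff] at hx
    grind
  · exact K.hAC.touches_right n1 fun x hx => .inl (.inl hx)
  · exact K.hCC.touches_right n3 fun x hx => .inl (.inl hx)
  · exact K.hDD.touches_left n5 fun x hx => .inr hx
  · exact K.hDB.touches_left n6 fun x hx => .inr hx
  · have := K.hCC.right_mem
    have := K.hDD.left_mem
    intro x hx
    simp only [Z, mem_union, mem_sdiff, mem_singleton_iff, mem_insert_iff] at hx ⊢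
    grind
  · exact fun x hx => .inl (.inl hx)
  · exact .inl (.inr K.hAD.right_mem)
  · exact .inl (.inr K.hCB.left_mem)
  · exact fun x hx => .inr hx

/-- One arc runs from `C₁` through `A`, `D₁`, `D₀`, `B` and down to `y`, the other from `C₁` through
`C₀` and up to `y`. -/
theorem exists_splits_of_mem {y : P} (hy : y ∈ K.QCB) (hy0 : y ≠ K.C₀) :
    ∃ U₂ U₃, K.Splits K.C₁ y U₂ U₃ ∧ K.QAC \ {K.C₁} ⊆ U₂ ∧ K.D₁ ∈ U₂ ∧ K.C₀ ∈ U₃ := by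
  obtain ⟨n1, n2, n3, n4, n5, n6, n7⟩ := K.corners_ne
  have hCy : K.C₀ < y := lt_of_le_of_ne (K.hCB.le_left y hy) hy0.symm
  have hyB := K.hCB.le_right y hy
  have hDy : K.D₀ ≠ y := by
    have := K.constraints K.D₀
    have := K.D₀_le_B
    have := K.D₀_le_D₁
    grind
  have hwy : K.C₁ ≠ y := by
    have := K.constraints K.C₁
    have := K.A_le_C₁
    grind
  have hup : ∀ x ∈ K.QCB, y < x → ∀ z ∈ K.QCB, x ≤ z → z ∈ {x ∈ K.QCB | y < x} :=
    fun x _ hyx z hz hxz => ⟨hz, hyx.trans_le hxz⟩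
  refine ⟨(K.QAC \ {K.C₁}) ∪ K.QAD ∪ K.QDD ∪ ((K.QDB \ {y}) ∪ {x ∈ K.QCB | y < x}),
    (K.QCC \ {K.C₁}) ∪ {x ∈ K.QCB | x < y},
    ⟨hwy, ?_, ?_, ?_, ?_, ?_, ?_, ?_, ?_, ?_, ?_, ?_, ?_⟩, ?_, ?_, ?_⟩
  · have h1 : (SimpleGraph.hasse P).IsConnSet ((K.QDB \ {y}) ∪ {x ∈ K.QCB | y < x}) := by
      -- For `y = B` the piece of `QCB` above `y` is empty and `QDB` ends at `y` itself; otherwise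
      -- `QDB` misses `y` by tightness.
      by_cases hB : y = K.B
      · have : {x ∈ K.QCB | y < x} = ∅ := by
          ext x
          simp only [mem_ofPred_eq, mem_empty_iff_false, iff_false, not_and]
          exact fun hx h => (K.hCB.le_right x hx).not_gt (hB ▸ h)
        rw [this, union_empty, hB]
        exact K.hDB.isConnSet_diff_right
      · have hyQ : y ∉ K.QDB := fun h => hB (K.tight_B y hyB hCy.le (K.hDB.le_left y h))
        rw [sdiff_singleton_eq_self hyQ]
        exact K.hDB.isConnSet.union (K.hCB.isConnSet_gt y) K.hDB.right_mem
          ⟨K.hCB.right_mem, lt_of_le_of_ne hyB hB⟩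
    exact ((K.hAC.isConnSet_diff_right.union K.hAD.isConnSet ⟨K.hAC.left_mem, n1⟩
      K.hAD.left_mem).union K.hDD.isConnSet (.inr K.hAD.right_mem) K.hDD.right_mem).union h1
      (.inr K.hDD.left_mem) (.inl ⟨K.hDB.left_mem, hDy⟩)
  · exact K.hCC.isConnSet_diff_right.union (K.hCB.isConnSet_lt y) ⟨K.hCC.left_mem, n3⟩
      ⟨K.hCB.left_mem, hCy⟩
  · intro x hx hx'
    have := K.bounds x
    have := K.constraints x
    have : y < x → ¬ x < y := fun h => h.asymm
    have : x = K.B → ¬ x < y := fun h h' => (h ▸ h').not_ge hyB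
    have : y < x → x ≠ K.C₀ := fun h h' => (h' ▸ h).asymm hCy
    simp only [mem_union, mem_sdiff, mem_singleton_iff, mem_ofPred_eq] at hx hx'
    grind
  · intro hx
    have := K.bounds K.C₁
    have := K.constraints K.C₁
    have := K.C₀_le_C₁
    have := K.A_le_C₁
    simp only [mem_union, mem_sdiff, mem_singleton_iff, mem_ofPred_eq] at hx
    grind
  · intro hx
    have := K.bounds K.C₁
    have := K.constraints K.C₁
    have := K.C₀_le_C₁
    have := K.A_le_C₁
    simp only [mem_union, mem_sdiff, mem_singleton_iff, mem_ofPred_eq] at hx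
    grind
  · intro hx
    have := K.bounds y
    have := K.constraints y
    have := hCy.le
    have := lt_irrefl y
    simp only [mem_union, mem_sdiff, mem_singleton_iff, mem_ofPred_eq] at hx
    grind
  · intro hx
    have := K.bounds y
    have := K.constraints y
    have := lt_irrefl y
    simp only [mem_union, mem_sdiff, mem_singleton_iff, mem_ofPred_eq] at hx
    grind
  · exact K.hAC.touches_right n1 fun x hx => .inl (.inl (.inl hx))
  · exact K.hCC.touches_right n3 fun x hx => .inl hx
  · by_cases hB : y = K.B
    · subst hB
      exact K.hDB.touches_right n6 fun x hx => .inr (.inl hx)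
    · obtain ⟨x, hx, hc⟩ := K.hCB.up y hy hB
      exact ⟨x, .inr (.inr ⟨hx, hc.lt⟩), .inr hc⟩
  · obtain ⟨x, hx, hc⟩ := K.hCB.down y hy hy0
    exact ⟨x, .inr ⟨hx, hc.lt⟩, .inl hc⟩
  · have := K.hCC.right_mem
    intro x hx
    simp only [Z, mem_union, mem_sdiff, mem_singleton_iff, mem_insert_iff, mem_ofPred_eq] at hx ⊢
    grind
  · exact fun x hx => .inl (.inl (.inl hx))
  · exact .inl (.inl (.inr K.hAD.right_mem))
  · exact .inl ⟨K.hCC.left_mem, n3⟩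

/-- Connected vertex sets off the cycle that attach at two interlacing pairs of vertices of the
cycle are separated by the cycle in every planar drawing of the cover graph. -/
theorem not_linked_of_splits (D : PlanarDrawing (SimpleGraph.hasse P)) {w y : P} {U₁ U₂ U₃ Q : Set P}
    (hs : K.Splits w y U₂ U₃) (hU₁ : (SimpleGraph.hasse P).IsConnSet U₁)
    (hQ : (SimpleGraph.hasse P).IsConnSet Q) (hUZ : ∀ x ∈ U₁, x ∉ K.Z) (hQZ : ∀ x ∈ Q, x ∉ K.Z)
    (hd : ∀ x ∈ Q, x ∉ U₁) (hw : (SimpleGraph.hasse P).Touches U₁ w)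
    (hy : (SimpleGraph.hasse P).Touches U₁ y)
    (hx2 : ∃ x ∈ U₂, (SimpleGraph.hasse P).Touches Q x)
    (hx3 : ∃ x ∈ U₃, (SimpleGraph.hasse P).Touches Q x)
    {E : Set ℂ} (hE : IsPreconnected E) (hEd : Disjoint E (D.support K.Z)) {p q : P} (hp : p ∈ U₁)
    (hq : q ∈ Q) (hpE : D.pt p ∈ E) (hqE : D.pt q ∈ E) : False := by
  have hwZ : w ∈ K.Z := hs.sub (by simp)
  have hyZ : y ∈ K.Z := hs.sub (by simp)
  have h2 : ∀ x ∈ U₂, x ∈ K.Z := fun x hx => hs.sub (.inl (.inl hx))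
  have h3 : ∀ x ∈ U₃, x ∈ K.Z := fun x hx => hs.sub (.inl (.inr hx))
  exact D.no_planar_K33_minor hs.ne ⟨fun h => hUZ _ h hwZ, hs.w₂, hs.w₃, fun h => hQZ _ h hwZ⟩
    ⟨fun h => hUZ _ h hyZ, hs.y₂, hs.y₃, fun h => hQZ _ h hyZ⟩
    (disjoint_left.2 fun x h h' => hUZ x h (h2 x h'))
    (disjoint_left.2 fun x h h' => hUZ x h (h3 x h')) (disjoint_left.2 hs.disj)
    (disjoint_left.2 hd) (disjoint_left.2 fun x h h' => hQZ x h (h2 x h'))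
    (disjoint_left.2 fun x h h' => hQZ x h (h3 x h')) hU₁ hs.conn₂ hs.conn₃ hQ hw hs.tw₂ hs.tw₃
    hy hs.ty₂ hs.ty₃ hx2 hx3 hE (hEd.mono_right (D.support_mono hs.sub)) hp hq hpE hqE

end CrownCycle

/-! ### Links between attachment places of the cycle, and separation. -/

namespace SimpleGraph

variable {P : Type*} [PartialOrder P]

/-- Equality is taken over the type `P`, so that connectivity and adjacency proved for the dual
poset can be read in the original one. -/
theorem hasse_orderDual_eq : @Eq (SimpleGraph P) (hasse Pᵒᵈ) (hasse P) := by
  have h : ∀ a b : P, (hasse Pᵒᵈ).Adj (OrderDual.toDual a) (OrderDual.toDual b) ↔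
      (hasse P).Adj a b := fun a b => by
    rw [hasse_adj, hasse_adj, toDual_covBy_toDual_iff, toDual_covBy_toDual_iff, or_comm]
  exact SimpleGraph.ext (funext fun a => funext fun b => propext (h a b))

theorem IsConnSet.of_dual {U : Set P} (h : IsConnSet (V := P) (hasse Pᵒᵈ) U) :
    (hasse P).IsConnSet U :=
  Eq.mp (congrArg (fun G : SimpleGraph P => G.IsConnSet U) hasse_orderDual_eq) h

theorem Touches.of_dual {U : Set P} {v : P} (h : Touches (V := P) (hasse Pᵒᵈ) U v) :
    (hasse P).Touches U v :=
  Eq.mp (congrArg (fun G : SimpleGraph P => G.Touches U v) hasse_orderDual_eq) h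

/-- The elements between some `s a` and `m` are all linked to `m`, and a saturated chain from `m`
leads up to a neighbour of `c`. -/
theorem exists_connSet_below [Finite P] {m c : P} (hmc : m < c) (s : Bool → P)
    (hs : ∀ a, s a ≤ m) : ∃ L : Set P, (hasse P).IsConnSet L ∧ (∀ a, s a ∈ L) ∧
      (hasse P).Touches L c ∧ (∀ x ∈ L, x < c) ∧ ∀ x ∈ L, ∃ a, s a ≤ x := by
  obtain ⟨Q, hQ⟩ := IsSatChain.exists_of_le hmc.le
  have h1 : (hasse P).IsConnSet {x | x ≤ m ∧ ∃ a, s a ≤ x} := by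
    refine .of_root m fun x hx => ?_
    obtain ⟨R, hR⟩ := IsSatChain.exists_of_le hx.1
    obtain ⟨a, ha⟩ := hx.2
    exact hR.linkedIn_right hR.left_mem fun y hy hxy => ⟨hR.le_right y hy, a, ha.trans hxy⟩
  refine ⟨{x | x ≤ m ∧ ∃ a, s a ≤ x} ∪ (Q \ {c}), ?_, ?_, ?_, ?_, ?_⟩
  · exact h1.union hQ.isConnSet_diff_right (r := m) ⟨le_rfl, true, hs _⟩ ⟨hQ.left_mem, hmc.ne⟩
  · exact fun a => .inl ⟨hs a, a, le_rfl⟩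
  · exact hQ.touches_right hmc.ne subset_union_right
  · rintro x (hx | hx)
    exacts [hx.1.trans_lt hmc, lt_of_le_of_ne (hQ.le_right x hx.1) hx.2]
  · rintro x (hx | hx)
    exacts [hx.2, ⟨true, (hs _).trans (hQ.le_left x hx.1)⟩]

theorem exists_connSet_above [Finite P] {m c : P} (hmc : c < m) (t : Bool → P)
    (ht : ∀ a, m ≤ t a) : ∃ L : Set P, (hasse P).IsConnSet L ∧ (∀ a, t a ∈ L) ∧
      (hasse P).Touches L c ∧ (∀ x ∈ L, c < x) ∧ ∀ x ∈ L, ∃ a, x ≤ t a := by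
  obtain ⟨L, h1, h2, h3, h4, h5⟩ := exists_connSet_below (P := Pᵒᵈ) (m := m) (c := c) hmc t ht
  exact ⟨L, IsConnSet.of_dual (P := P) h1, h2, Touches.of_dual (P := P) h3, h4, h5⟩

end SimpleGraph

/-- Two saturated chains `R a` from a connected set `Lc` attached to the cycle at `C₀` from below
to a connected set `Ld` attached to the cycle at `D₁` from above. -/
structure CrownLink {P : Type*} [PartialOrder P] (K : CrownCycle P) where
  (s t : Bool → P)
  R : Bool → Set P
  (Lc Ld : Set P)
  hR : ∀ a, IsSatChain (s a) (t a) (R a)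
  not_st : ∀ a, ¬ s (!a) ≤ t a
  conn_Lc : (SimpleGraph.hasse P).IsConnSet Lc
  s_mem : ∀ a, s a ∈ Lc
  touches_C₀ : (SimpleGraph.hasse P).Touches Lc K.C₀
  lt_C₀ : ∀ x ∈ Lc, x < K.C₀
  exists_s_le : ∀ x ∈ Lc, ∃ a, s a ≤ x
  conn_Ld : (SimpleGraph.hasse P).IsConnSet Ld
  t_mem : ∀ a, t a ∈ Ld
  touches_D₁ : (SimpleGraph.hasse P).Touches Ld K.D₁
  D₁_lt : ∀ x ∈ Ld, K.D₁ < x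
  exists_le_t : ∀ x ∈ Ld, ∃ a, x ≤ t a

namespace CrownCycle

variable {P : Type*} [PartialOrder P] (K : CrownCycle P)

theorem notMem_Z_of_lt_C₀ {x : P} (h : x < K.C₀) : x ∉ K.Z := by
  intro hx
  have := K.bounds x
  have := K.constraints x
  have := h.le.trans K.C₀_le_C₁
  have := h.le.trans K.C₀_le_B
  have := h.not_ge
  simp only [Z, mem_union] at hx
  grind

theorem notMem_Z_of_D₁_lt {x : P} (h : K.D₁ < x) : x ∉ K.Z := by
  intro hx
  have := K.bounds x
  have := K.constraints x
  have := K.A_le_D₁.trans h.le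
  have := K.D₀_le_D₁.trans h.le
  have := h.not_ge
  simp only [Z, mem_union] at hx
  grind

end CrownCycle

namespace CrownLink

variable {P : Type*} [PartialOrder P] {K : CrownCycle P} (L : CrownLink K)

theorem not_st' (a : Bool) : ¬ L.s a ≤ L.t (!a) := by
  simpa using L.not_st (!a)

/-- On each of the other four chains `x` is above `C₀` or below `D₁`; either would yield a forbidden
comparability between the two link chains. -/
theorem mem_QAC_or_QDB {a : Bool} {x : P} (hx : x ∈ L.R a) (hZ : x ∈ K.Z) :
    x ∈ K.QAC ∨ x ∈ K.QDB := by
  have h1 : ¬ K.C₀ ≤ x := fun h => L.not_st a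
    ((L.lt_C₀ _ (L.s_mem _)).le.trans (h.trans ((L.hR a).le_right x hx)))
  have h2 : ¬ x ≤ K.D₁ := fun h => L.not_st' a
    (((L.hR a).le_left x hx).trans (h.trans (L.D₁_lt _ (L.t_mem _)).le))
  have := K.bounds x
  simp only [CrownCycle.Z, mem_union] at hZ
  tauto

theorem not_le_of_mem {a : Bool} {x y : P} (hx : x ∈ L.R a) (hy : y ∈ L.R !a) : ¬ x ≤ y :=
  fun h => L.not_st' a (((L.hR a).le_left x hx).trans (h.trans ((L.hR _).le_right y hy)))

/-- The chain misses the cycle, or first meets it on `QAC`. -/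
def Good (a : Bool) : Prop :=
  (∀ x ∈ L.R a, x ∉ K.Z) ∨ ∃ y ∈ L.R a, y ∈ K.QAC ∧ ∀ x ∈ L.R a, x ∈ K.Z → y ≤ x

variable [Finite P]

/-- The first meeting then lies on `QDB`, above `D₀`; a later one on `QAC` would give `D₀ ≤ C₁`. -/
theorem forall_mem_QDB_of_not_good {a : Bool} (h : ¬ L.Good a) :
    (∃ x ∈ L.R a, x ∈ K.Z) ∧ ∀ x ∈ L.R a, x ∈ K.Z → x ∈ K.QDB := by
  simp only [Good, not_or, not_forall, not_not, not_exists, not_and] at h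
  obtain ⟨⟨x, hx, hxZ⟩, h⟩ := h
  refine ⟨⟨x, hx, hxZ⟩, ?_⟩
  obtain ⟨y, hy⟩ := (toFinite {x | x ∈ L.R a ∧ x ∈ K.Z}).exists_minimal ⟨x, hx, hxZ⟩
  have hmin : ∀ x ∈ L.R a, x ∈ K.Z → y ≤ x := fun x hx hxZ =>
    ((L.hR a).total y hy.1.1 x hx).elim id fun hle => hy.2 ⟨hx, hxZ⟩ hle
  have hyD : y ∈ K.QDB := (L.mem_QAC_or_QDB hy.1.1 hy.1.2).resolve_left fun hyA => by
    obtain ⟨z, hz, hzZ, hn⟩ := h y hy.1.1 hyA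
    exact hn (hmin z hz hzZ)
  intro x hx hxZ
  refine (L.mem_QAC_or_QDB hx hxZ).resolve_left fun hxA => ?_
  exact K.not_DC ((K.hDB.le_left y hyD).trans ((hmin x hx hxZ).trans (K.hAC.le_right x hxA)))

/-- If both chains were bad they would both meet the chain `QDB`, producing a comparability between
them. -/
theorem good_or_good_not (a : Bool) : L.Good a ∨ L.Good (!a) := by
  by_contra! h
  obtain ⟨⟨x, hx, hxZ⟩, h1⟩ := L.forall_mem_QDB_of_not_good h.1
  obtain ⟨⟨y, hy, hyZ⟩, h2⟩ := L.forall_mem_QDB_of_not_good h.2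
  rcases K.hDB.total x (h1 x hx hxZ) y (h2 y hy hyZ) with hle | hle
  · exact L.not_le_of_mem hx hy hle
  · exact L.not_le_of_mem hy (by simpa using hx) hle

/-- The piece follows the link chain upwards from `Lc`, stopping just before the cycle, or running
on through `Ld` if it never meets the cycle. The final alternative records which of the two happens.
-/
theorem exists_piece_of_good {a : Bool} (h : L.Good a) :
    ∃ U : Set P, (SimpleGraph.hasse P).IsConnSet U ∧ L.Lc ⊆ U ∧ (∀ x ∈ U, x ∉ K.Z) ∧
      (SimpleGraph.hasse P).Touches U K.C₀ ∧
      (∃ e, (SimpleGraph.hasse P).Touches U e ∧ (e ∈ K.QAC ∧ e ≠ K.C₁ ∨ e = K.D₁)) ∧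
      ((∀ x ∈ U, x ∈ L.Lc ∨ x ∈ L.R a ∧ x ≤ K.C₁) ∨
        (∀ x ∈ L.R a, x ∉ K.Z) ∧ U = L.Lc ∪ L.R a ∪ L.Ld) := by
  rcases h with h | ⟨y, hy, hyA, hmin⟩
  · refine ⟨L.Lc ∪ L.R a ∪ L.Ld, ?_, fun x hx => .inl (.inl hx), ?_, ?_,
      ⟨K.D₁, L.touches_D₁.mono subset_union_right, .inr rfl⟩, .inr ⟨h, rfl⟩⟩
    · exact (L.conn_Lc.union (L.hR a).isConnSet (L.s_mem a) (L.hR a).left_mem).union L.conn_Ld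
        (.inr (L.hR a).right_mem) (L.t_mem a)
    · rintro x ((hx | hx) | hx)
      exacts [K.notMem_Z_of_lt_C₀ (L.lt_C₀ x hx), h x hx, K.notMem_Z_of_D₁_lt (L.D₁_lt x hx)]
    · exact L.touches_C₀.mono fun x hx => .inl (.inl hx)
  · have hyZ : y ∈ K.Z := .inl (.inl (.inl (.inl (.inl hyA))))
    have hsy : L.s a ≠ y := fun h => K.notMem_Z_of_lt_C₀ (L.lt_C₀ _ (L.s_mem a)) (h ▸ hyZ)
    refine ⟨L.Lc ∪ {x ∈ L.R a | x < y}, ?_, subset_union_left, ?_, ?_, ⟨y, ?_, .inl ⟨hyA, ?_⟩⟩,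
      .inl ?_⟩
    · exact L.conn_Lc.union ((L.hR a).isConnSet_lt y) (L.s_mem a)
        ⟨(L.hR a).left_mem, lt_of_le_of_ne ((L.hR a).le_left y hy) hsy⟩
    · rintro x (hx | hx)
      exacts [K.notMem_Z_of_lt_C₀ (L.lt_C₀ x hx), fun hxZ => (hmin x hx.1 hxZ).not_gt hx.2]
    · exact L.touches_C₀.mono subset_union_left
    · obtain ⟨x, hx, hc⟩ := (L.hR a).down y hy hsy.symm
      exact ⟨x, .inr ⟨hx, hc.lt⟩, .inl hc⟩
    · rintro rfl
      exact L.not_st a ((L.lt_C₀ _ (L.s_mem _)).le.trans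
        (K.C₀_le_C₁.trans ((L.hR a).le_right _ hy)))
    · rintro x (hx | hx)
      exacts [.inl hx, .inr ⟨hx.1, hx.2.le.trans (K.hAC.le_right y hyA)⟩]

/-- Here the chain is followed downwards from `Ld` to just above its last meeting with the cycle. -/
theorem exists_piece_of_not_good {a : Bool} (h : ¬ L.Good a) :
    ∃ U : Set P, (SimpleGraph.hasse P).IsConnSet U ∧ L.Ld ⊆ U ∧ (∀ x ∈ U, x ∉ K.Z) ∧
      (SimpleGraph.hasse P).Touches U K.D₁ ∧
      (∃ e, (SimpleGraph.hasse P).Touches U e ∧ e ∈ K.QDB ∧ e ≠ K.D₀) ∧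
      (∀ x ∈ U, x ∈ L.R a ∨ x ∈ L.Ld) := by
  obtain ⟨⟨x, hx, hxZ⟩, hall⟩ := L.forall_mem_QDB_of_not_good h
  obtain ⟨y, hy⟩ := (toFinite {x | x ∈ L.R a ∧ x ∈ K.Z}).exists_maximal ⟨x, hx, hxZ⟩
  have hmax : ∀ x ∈ L.R a, x ∈ K.Z → x ≤ y := fun x hx hxZ =>
    ((L.hR a).total x hx y hy.1.1).elim id fun hle => hy.2 ⟨hx, hxZ⟩ hle
  have hyt : y ≠ L.t a := fun h => K.notMem_Z_of_D₁_lt (L.D₁_lt _ (L.t_mem a)) (h ▸ hy.1.2)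
  refine ⟨{x ∈ L.R a | y < x} ∪ L.Ld, ?_, subset_union_right, ?_,
    L.touches_D₁.mono subset_union_right, ⟨y, ?_, hall y hy.1.1 hy.1.2, ?_⟩, ?_⟩
  · exact ((L.hR a).isConnSet_gt y).union L.conn_Ld
      ⟨(L.hR a).right_mem, lt_of_le_of_ne ((L.hR a).le_right y hy.1.1) hyt⟩ (L.t_mem a)
  · rintro x (hx | hx)
    exacts [fun hxZ => (hmax x hx.1 hxZ).not_gt hx.2, K.notMem_Z_of_D₁_lt (L.D₁_lt x hx)]
  · obtain ⟨x, hx, hc⟩ := (L.hR a).up y hy.1.1 hyt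
    exact ⟨x, .inl ⟨hx, hc.lt⟩, .inr hc⟩
  · rintro rfl
    exact L.not_st' a (((L.hR a).le_left _ hy.1.1).trans
      (K.D₀_le_D₁.trans (L.D₁_lt _ (L.t_mem _)).le))
  · rintro x (hx | hx)
    exacts [.inl hx.1, .inr hx]

/-- The cycle separates the vertices linked to `C₀` from below from those linked to `C₁` from
above. -/
theorem separates (L' : CrownLink K.dual) (D : PlanarDrawing (SimpleGraph.hasse P)) {E : Set ℂ}
    (hE : IsPreconnected E) (hEd : Disjoint E (D.support K.Z)) {p q : P} (hp : p ∈ L.Lc)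
    (hq : q ∈ (show Set P from L'.Lc)) (hpE : D.pt p ∈ E) (hqE : D.pt q ∈ E) : False := by
  -- The dual link is read in the order of `P`: its chains run from `lo b`, below `D₀`, up to `hi
  -- b`, above `C₁`.
  let lo : Bool → P := L'.t
  let hi : Bool → P := L'.s
  let R' : Bool → Set P := L'.R
  let Lc' : Set P := L'.Lc
  let Ld' : Set P := L'.Ld
  have hlo : ∀ b, ∀ x ∈ R' b, lo b ≤ x := fun b x hx => (L'.hR b).le_right x hx
  have hhi : ∀ b, ∀ x ∈ R' b, x ≤ hi b := fun b x hx => (L'.hR b).le_left x hx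
  have htot : ∀ b, ∀ x ∈ R' b, ∀ y ∈ R' b, x ≤ y ∨ y ≤ x := fun b x hx y hy =>
    (L'.hR b).total y hy x hx
  have hn : ∀ b, ∀ x : P, lo b ≤ x → ¬ x ≤ hi (!b) := fun b x h h' => L'.not_st b (h.trans h')
  have hLc' : ∀ x ∈ Lc', K.C₁ < x := L'.lt_C₀
  have hLd' : ∀ x ∈ Ld', x < K.D₀ := L'.D₁_lt
  have hLc'' : ∀ x ∈ Lc', ∃ b, x ≤ hi b := L'.exists_s_le
  have hLd'' : ∀ x ∈ Ld', ∃ b, lo b ≤ x := L'.exists_le_t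
  have hC₁hi : ∀ b, K.C₁ ≤ hi b := fun b => (hLc' _ (L'.s_mem b)).le
  have hloD₀ : ∀ b, lo b ≤ K.D₀ := fun b => (hLd' _ (L'.t_mem b)).le
  have hsC₀ : ∀ a, L.s a ≤ K.C₀ := fun a => (L.lt_C₀ _ (L.s_mem a)).le
  have hD₁t : ∀ a, K.D₁ ≤ L.t a := fun a => (L.D₁_lt _ (L.t_mem a)).le
  have hm : ∀ a, ∀ x : P, L.s a ≤ x → ¬ x ≤ L.t (!a) := fun a x h h' => L.not_st' a (h.trans h')
  have hm' : ∀ a, ∀ x : P, L.s (!a) ≤ x → ¬ x ≤ L.t a := fun a x h h' => L.not_st a (h.trans h')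
  -- the two links can meet only on their chains
  have cross : ∀ a b x, x ∈ L.Lc ∪ L.R a ∪ L.Ld → x ∈ Lc' ∪ R' b ∪ Ld' → x ∈ L.R a ∧ x ∈ R' b := by
    rintro a b x ((h | h) | h) ((h' | h') | h')
    · exact absurd (((L.lt_C₀ x h).trans_le K.C₀_le_C₁).trans (hLc' x h')) (lt_irrefl x)
    · exact absurd ((L.lt_C₀ x h).le.trans (K.C₀_le_C₁.trans (hC₁hi _))) (hn b x (hlo b x h'))
    · obtain ⟨i, hi⟩ := L.exists_s_le x h
      exact absurd ((hLd' x h').le.trans (K.D₀_le_D₁.trans (hD₁t _))) (hm i x hi)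
    · exact absurd ((L.hR a).le_right x h)
        (hm' a x ((hsC₀ _).trans (K.C₀_le_C₁.trans (hLc' x h').le)))
    · exact ⟨h, h'⟩
    · exact absurd ((hLd' x h').le.trans (K.D₀_le_D₁.trans (hD₁t _)))
        (hm a x ((L.hR a).le_left x h))
    · obtain ⟨i, hi⟩ := L.exists_le_t x h
      exact absurd hi (hm' i x ((hsC₀ _).trans (K.C₀_le_C₁.trans (hLc' x h').le)))
    · have := hn (!b) x ((hloD₀ _).trans (K.D₀_le_D₁.trans (L.D₁_lt x h).le))
      rw [Bool.not_not] at this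
      exact absurd (hhi b x h') this
    · exact absurd ((((hLd' x h').trans_le K.D₀_le_D₁).trans (L.D₁_lt x h))) (lt_irrefl x)
  obtain ⟨a, ha⟩ : ∃ a, L.Good a := (L.good_or_good_not true).elim (⟨_, ·⟩) (⟨_, ·⟩)
  obtain ⟨b, hb⟩ : ∃ b, L'.Good b := (L'.good_or_good_not true).elim (⟨_, ·⟩) (⟨_, ·⟩)
  obtain ⟨U, hU, hLU, hUZ, hUC, ⟨e, hUe, he⟩, hUsub⟩ := L.exists_piece_of_good ha
  obtain ⟨U', hU', hLU', hUZ', hUC', ⟨f, hUf', hf⟩, hUsub'⟩ :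
      ∃ U' : Set P, (SimpleGraph.hasse P).IsConnSet U' ∧ Lc' ⊆ U' ∧ (∀ x ∈ U', x ∉ K.Z) ∧
      (SimpleGraph.hasse P).Touches U' K.C₁ ∧
      (∃ f, (SimpleGraph.hasse P).Touches U' f ∧ (f ∈ K.QCB ∧ f ≠ K.C₀ ∨ f = K.D₀)) ∧
      ((∀ x ∈ U', x ∈ Lc' ∨ x ∈ R' b ∧ K.C₀ ≤ x) ∨
        (∀ x ∈ R' b, x ∉ K.Z) ∧ U' = Lc' ∪ R' b ∪ Ld') := by
    obtain ⟨U', h1, h2, h3, h4, ⟨f, h5, h6⟩, h7⟩ := L'.exists_piece_of_good hb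
    rw [K.dual_Z] at h3 h7
    exact ⟨U', SimpleGraph.IsConnSet.of_dual (P := P) h1, h2, h3,
      SimpleGraph.Touches.of_dual (P := P) h4, ⟨f, SimpleGraph.Touches.of_dual (P := P) h5, h6⟩, h7⟩
  -- If the two pieces are disjoint, the attachments `C₁`, `f` of one interlace with `C₀`, `e` of
  -- the other, and `E` is the missing edge.
  by_cases hdisj : ∀ x ∈ U, x ∉ U'
  · obtain ⟨U₂, U₃, hs, h2, h2', h3⟩ : ∃ U₂ U₃, K.Splits K.C₁ f U₂ U₃ ∧ K.QAC \ {K.C₁} ⊆ U₂ ∧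
        K.D₁ ∈ U₂ ∧ K.C₀ ∈ U₃ := by
      rcases hf with ⟨hf, hf0⟩ | rfl
      · exact K.exists_splits_of_mem hf hf0
      · obtain ⟨U₂, U₃, h1, h2, h3, h4, -⟩ := K.exists_splits_D₀
        exact ⟨U₂, U₃, h1, h2, h3, h4⟩
    refine K.not_linked_of_splits D hs hU' hU hUZ' hUZ hdisj hUC' hUf' ⟨e, ?_, hUe⟩ ⟨_, h3, hUC⟩
      hE hEd (hLU' hq) (hLU hp) hqE hpE
    rcases he with ⟨he, he0⟩ | rfl
    exacts [h2 ⟨he, he0⟩, h2']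
  push Not at hdisj
  obtain ⟨x, hxU, hxU'⟩ := hdisj
  have hsub : ∀ {a} {U : Set P}, ((∀ x ∈ U, x ∈ L.Lc ∨ x ∈ L.R a ∧ x ≤ K.C₁) ∨
      (∀ x ∈ L.R a, x ∉ K.Z) ∧ U = L.Lc ∪ L.R a ∪ L.Ld) → U ⊆ L.Lc ∪ L.R a ∪ L.Ld := by
    rintro a U (h | ⟨-, h⟩) x hx
    · exact (h x hx).elim (fun h => .inl (.inl h)) fun h => .inl (.inr h.1)
    · exact h ▸ hx
  have hsub' : U' ⊆ Lc' ∪ R' b ∪ Ld' := by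
    rcases hUsub' with h | ⟨-, h⟩
    · exact fun x hx => (h x hx).elim (fun h => .inl (.inl h)) fun h => .inl (.inr h.1)
    · exact h.le
  obtain ⟨hxR, hxR'⟩ := cross a b x (hsub hUsub hxU) (hsub' hxU')
  -- Pieces that meet cannot be truncated: truncation would put the common vertex below `C₁`, or
  -- above `C₀` for the dual link, against the incomparabilities. Both chains therefore miss the
  -- cycle.
  obtain ⟨-, hUeq⟩ := hUsub.resolve_left fun h => by
    have hx1 : x ≤ K.C₁ := (h x hxU).elim (fun h => (L.lt_C₀ x h).le.trans K.C₀_le_C₁) (·.2)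
    exact hn b x (hlo b x hxR') (hx1.trans (hC₁hi _))
  obtain ⟨-, hUeq'⟩ := hUsub'.resolve_left fun h => by
    have hx1 : K.C₀ ≤ x := (h x hxU').elim (fun h => K.C₀_le_C₁.trans (hLc' x h).le) (·.2)
    exact hm' a x ((hsC₀ _).trans hx1) ((L.hR a).le_right x hxR)
  -- The other chain of the first link avoids `R' b`: that chain already contains a vertex of `L.R
  -- a`, incomparable to all of `L.R (!a)`.
  have hRR : ∀ z ∈ L.R (!a), z ∉ R' b := by
    intro z hz hz'
    rcases htot b x hxR' z hz' with h | h
    · exact L.not_le_of_mem hxR hz h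
    · exact L.not_le_of_mem hz (by simpa using hxR) h
  have hUD : (SimpleGraph.hasse P).Touches U' K.D₀ := by
    have : (SimpleGraph.hasse P).Touches Ld' K.D₀ := SimpleGraph.Touches.of_dual L'.touches_D₁
    exact this.mono (hUeq' ▸ subset_union_right)
  -- The drawing of the two meeting pieces is connected and misses the cycle, so it now replaces
  -- `E`; the interlacing partner of `U'` is a piece from the other chain.
  have hEc : IsPreconnected (D.support (U ∪ U')) := D.isPreconnected_support (hU.union hU' hxU hxU')
  have hEZ : Disjoint (D.support (U ∪ U')) (D.support K.Z) :=
    D.disjoint_support (disjoint_left.2 fun z hz => hz.elim (hUZ z) (hUZ' z))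
  obtain ⟨U₂, U₃, hs, h2, h2', h3, h3'⟩ := K.exists_splits_D₀
  by_cases hg : L.Good !a
  · obtain ⟨Q, hQ, hLQ, hQZ, hQC, ⟨e', hQe, he'⟩, hQsub⟩ := L.exists_piece_of_good hg
    have hdQ : ∀ z ∈ Q, z ∉ U' := fun z hz hz' => by
      have := cross (!a) b z (hsub hQsub hz) (hsub' hz')
      exact hRR z this.1 this.2
    refine K.not_linked_of_splits D hs hU' hQ hUZ' hQZ hdQ hUC' hUD ⟨e', ?_, hQe⟩ ⟨_, h3, hQC⟩
      hEc hEZ (hLU' hq) (hLQ hp) (D.pt_mem_support (.inr (hLU' hq)))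
      (D.pt_mem_support (.inl (hLU hp)))
    rcases he' with ⟨he, he0⟩ | rfl
    exacts [h2 ⟨he, he0⟩, h2']
  · obtain ⟨Q, hQ, hLQ, hQZ, hQD, ⟨e', hQe, he', he0⟩, hQsub⟩ := L.exists_piece_of_not_good hg
    have hdQ : ∀ z ∈ Q, z ∉ U' := fun z hz hz' => by
      have := cross (!a) b z ((hQsub z hz).elim (fun h => .inl (.inr h)) .inr) (hsub' hz')
      exact hRR z this.1 this.2
    -- In the bad case the partner is attached at `D₁` and on `QDB`, and it reaches `U` through the
    -- common set `Ld` rather than `Lc`.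
    have ht : L.t a ∈ U := hUeq ▸ .inr (L.t_mem a)
    exact K.not_linked_of_splits D hs hU' hQ hUZ' hQZ hdQ hUC' hUD ⟨_, h2', hQD⟩
      ⟨e', h3' ⟨he', he0⟩, hQe⟩ hEc hEZ (hLU' hq) (hLQ (L.t_mem a))
      (D.pt_mem_support (.inr (hLU' hq))) (D.pt_mem_support (.inl ht))

end CrownLink

theorem CrownLink.exists_of_le {P : Type*} [PartialOrder P] [Finite P] (K : CrownCycle P) {m M : P}
    (s t : Bool → P) (hs : ∀ a, s a ≤ m) (hm : m < K.C₀) (hM : K.D₁ < M) (ht : ∀ a, M ≤ t a)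
    (hst : ∀ a, s a ≤ t a) (hn : ∀ a, ¬ s (!a) ≤ t a) : ∃ L : CrownLink K, ∀ a, s a ∈ L.Lc := by
  obtain ⟨Lc, h1, h2, h3, h4, h5⟩ := SimpleGraph.exists_connSet_below hm s hs
  obtain ⟨Ld, k1, k2, k3, k4, k5⟩ := SimpleGraph.exists_connSet_above hM t ht
  choose R hR using fun a => IsSatChain.exists_of_le (hst a)
  exact ⟨⟨s, t, R, Lc, Ld, hR, hn, h1, h2, h3, h4, h5, k1, k2, k3, k4, k5⟩, h2⟩

/-! ### Kelly posets: the cycles and the count. -/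

/-- The possible positions, relative to the index `i`, of a vertex on the `i`-th cycle; `S` and `T`
are the sets of all `j` with `a_j` below, respectively `b_j` above, that vertex. -/
def KellyPosition (n : ℕ) (S T : ℕ → Prop) (i : ℕ) : Prop :=
  (S i ∧ ∀ j, i < j → j ≤ n → T j) ∨ (S i ∧ ∀ j, 1 ≤ j → j < i → T j) ∨
  ((∀ j, 1 ≤ j → j < i → S j) ∧ T i) ∨ ((∀ j, i < j → j ≤ n → S j) ∧ T i) ∨
  ((∀ j, 1 ≤ j → j < i → S j) ∧ ∀ j, i < j → j ≤ n → T j) ∨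
  ((∀ j, i < j → j ≤ n → S j) ∧ ∀ j, 1 ≤ j → j < i → T j)

/-- Only the indices `1`, `i`, `j`, `l`, `n` matter. Restricted to these, each choice of three
positions puts some index in both `S` and `T`, a finite propositional check. -/
theorem KellyPosition.false_of_three {n : ℕ} {S T : ℕ → Prop}
    (hST : ∀ j, 1 ≤ j → j ≤ n → ¬ (S j ∧ T j)) {i j l : ℕ} (hi : 1 < i) (hij : i < j) (hjl : j < l)
    (hl : l < n) (h1 : KellyPosition n S T i) (h2 : KellyPosition n S T j)
    (h3 : KellyPosition n S T l) : False := by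
  have e1 := hST 1 le_rfl (by omega)
  have e2 := hST i (by omega) (by omega)
  have e3 := hST j (by omega) (by omega)
  have e4 := hST l (by omega) (by omega)
  have e5 := hST n (by omega) le_rfl
  have k1 : (S i ∧ T j ∧ T l ∧ T n) ∨ (S i ∧ T 1) ∨ (S 1 ∧ T i) ∨ (S j ∧ S l ∧ S n ∧ T i) ∨
      (S 1 ∧ T j ∧ T l ∧ T n) ∨ (S j ∧ S l ∧ S n ∧ T 1) := by
    have up : ∀ {X : ℕ → Prop}, (∀ m, i < m → m ≤ n → X m) → X j ∧ X l ∧ X n := fun h =>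
      ⟨h j hij (by omega), h l (by omega) (by omega), h n (by omega) le_rfl⟩
    rcases h1 with ⟨h, h'⟩ | ⟨h, h'⟩ | ⟨h, h'⟩ | ⟨h, h'⟩ | ⟨h, h'⟩ | ⟨h, h'⟩
    · exact .inl ⟨h, up h'⟩
    · exact .inr (.inl ⟨h, h' 1 le_rfl hi⟩)
    · exact .inr (.inr (.inl ⟨h 1 le_rfl hi, h'⟩))
    · have := up h; exact .inr (.inr (.inr (.inl ⟨this.1, this.2.1, this.2.2, h'⟩)))
    · exact .inr (.inr (.inr (.inr (.inl ⟨h 1 le_rfl hi, up h'⟩))))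
    · have := up h
      exact .inr (.inr (.inr (.inr (.inr ⟨this.1, this.2.1, this.2.2, h' 1 le_rfl hi⟩))))
  have k2 : (S j ∧ T l ∧ T n) ∨ (S j ∧ T 1 ∧ T i) ∨ (S 1 ∧ S i ∧ T j) ∨ (S l ∧ S n ∧ T j) ∨
      (S 1 ∧ S i ∧ T l ∧ T n) ∨ (S l ∧ S n ∧ T 1 ∧ T i) := by
    have up : ∀ {X : ℕ → Prop}, (∀ m, j < m → m ≤ n → X m) → X l ∧ X n := fun h =>
      ⟨h l hjl (by omega), h n (by omega) le_rfl⟩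
    have lo : ∀ {X : ℕ → Prop}, (∀ m, 1 ≤ m → m < j → X m) → X 1 ∧ X i := fun h =>
      ⟨h 1 le_rfl (by omega), h i (by omega) hij⟩
    rcases h2 with ⟨h, h'⟩ | ⟨h, h'⟩ | ⟨h, h'⟩ | ⟨h, h'⟩ | ⟨h, h'⟩ | ⟨h, h'⟩
    · exact .inl ⟨h, up h'⟩
    · exact .inr (.inl ⟨h, lo h'⟩)
    · exact .inr (.inr (.inl ⟨(lo h).1, (lo h).2, h'⟩))
    · exact .inr (.inr (.inr (.inl ⟨(up h).1, (up h).2, h'⟩)))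
    · exact .inr (.inr (.inr (.inr (.inl ⟨(lo h).1, (lo h).2, up h'⟩))))
    · exact .inr (.inr (.inr (.inr (.inr ⟨(up h).1, (up h).2, lo h'⟩))))
  have k3 : (S l ∧ T n) ∨ (S l ∧ T 1 ∧ T i ∧ T j) ∨ (S 1 ∧ S i ∧ S j ∧ T l) ∨ (S n ∧ T l) ∨
      (S 1 ∧ S i ∧ S j ∧ T n) ∨ (S n ∧ T 1 ∧ T i ∧ T j) := by
    have lo : ∀ {X : ℕ → Prop}, (∀ m, 1 ≤ m → m < l → X m) → X 1 ∧ X i ∧ X j := fun h =>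
      ⟨h 1 le_rfl (by omega), h i (by omega) (by omega), h j (by omega) hjl⟩
    rcases h3 with ⟨h, h'⟩ | ⟨h, h'⟩ | ⟨h, h'⟩ | ⟨h, h'⟩ | ⟨h, h'⟩ | ⟨h, h'⟩
    · exact .inl ⟨h, h' n hl le_rfl⟩
    · exact .inr (.inl ⟨h, lo h'⟩)
    · have := lo h; exact .inr (.inr (.inl ⟨this.1, this.2.1, this.2.2, h'⟩))
    · exact .inr (.inr (.inr (.inl ⟨h n hl le_rfl, h'⟩)))
    · have := lo h
      exact .inr (.inr (.inr (.inr (.inl ⟨this.1, this.2.1, this.2.2, h' n hl le_rfl⟩))))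
    · exact .inr (.inr (.inr (.inr (.inr ⟨h n hl le_rfl, lo h'⟩))))
  clear h1 h2 h3 hST hi hij hjl hl
  generalize S 1 = S1, S i = Si, S j = Sj, S l = Sl, S n = Sn, T 1 = T1, T i = Ti, T j = Tj,
    T l = Tl, T n = Tn at *
  grind

section Kelly

variable {P : Type*} [PartialOrder P] {n : ℕ}

theorem singleton_mem_kellyFamily {i : ℕ} (h1 : 1 ≤ i) (h2 : i ≤ n) : {i} ∈ kellyFamily n :=
  .inl ⟨i, h1, h2, rfl⟩

theorem sdiff_mem_kellyFamily {i : ℕ} (h1 : 1 ≤ i) (h2 : i ≤ n) :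
    Finset.Icc 1 n \ {i} ∈ kellyFamily n :=
  .inr (.inl ⟨i, h1, h2, rfl⟩)

theorem Icc_one_mem_kellyFamily {i : ℕ} (h1 : 1 ≤ i) (h2 : i + 1 ≤ n) :
    Finset.Icc 1 i ∈ kellyFamily n :=
  .inr (.inr (.inl ⟨i, h1, h2, rfl⟩))

theorem Icc_succ_mem_kellyFamily {i : ℕ} (h1 : 1 ≤ i) (h2 : i + 1 ≤ n) :
    Finset.Icc (i + 1) n ∈ kellyFamily n :=
  .inr (.inr (.inr ⟨i, h1, h2, rfl⟩))

/-- The `i`-th cycle of a Kelly poset: it separates `c₁` from `c_{n-1}`, and the vertices on it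
have restricted positions. -/
theorem exists_separating_cycle [Finite P] (D : PlanarDrawing (SimpleGraph.hasse P))
    {a b c d : ℕ → P} (hab : ∀ i j, 1 ≤ i → i ≤ n → 1 ≤ j → j ≤ n → (a i ≤ b j ↔ i ≠ j))
    (hac : ∀ i j, 1 ≤ i → i ≤ n → 1 ≤ j → j < n → (a i ≤ c j ↔ i ≤ j))
    (had : ∀ i j, 1 ≤ i → i ≤ n → 1 ≤ j → j < n → (a i ≤ d j ↔ j < i))
    (hcb : ∀ i j, 1 ≤ i → i < n → 1 ≤ j → j ≤ n → (c i ≤ b j ↔ i < j))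
    (hdb : ∀ i j, 1 ≤ i → i < n → 1 ≤ j → j ≤ n → (d i ≤ b j ↔ j ≤ i))
    (hcc : ∀ i j, 1 ≤ i → i < n → 1 ≤ j → j < n → (c i ≤ c j ↔ i ≤ j))
    (hdd : ∀ i j, 1 ≤ i → i < n → 1 ≤ j → j < n → (d i ≤ d j ↔ j ≤ i))
    (hcd : ∀ i j, 1 ≤ i → i < n → 1 ≤ j → j < n → ¬ c i ≤ d j)
    (hdc : ∀ i j, 1 ≤ i → i < n → 1 ≤ j → j < n → ¬ d i ≤ c j)
    {i : ℕ} (hi : 4 ≤ i) (hin : i + 3 ≤ n) :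
    ∃ Z : Set P, c 1 ∉ Z ∧ c (n - 1) ∉ Z ∧
      (∀ x ∈ Z, KellyPosition n (fun j => a j ≤ x) (fun j => x ≤ b j) i) ∧
      ∀ E : Set ℂ, IsPreconnected E → Disjoint E (D.support Z) → D.pt (c 1) ∈ E →
        D.pt (c (n - 1)) ∈ E → False := by
  obtain ⟨K, hA, hC₀, hD₀, hB, hD₁, hC₁⟩ := CrownCycle.exists_of_le
    (a := a i) (c₀ := c (i - 1)) (d₀ := d i) (b := b i) (d₁ := d (i - 1)) (c₁ := c i)
    (by rw [hac] <;> omega) (by rw [had] <;> omega) (by rw [hcc] <;> omega)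
    (by rw [hcb] <;> omega) (by rw [hdd] <;> omega) (by rw [hdb] <;> omega)
    (by rw [hab] <;> omega) (by apply hcd <;> omega) (by apply hdc <;> omega)
  -- The strict inequalities with `c 2`, `d 2` need `i ≥ 4`, those with `c (n - 2)`, `d (n - 2)`
  -- need `i ≤ n - 3`. This costs six indices.
  have l1 : c 2 < K.C₀ :=
    (lt_of_le_not_ge (b := c (i - 1)) (by rw [hcc] <;> omega) (by rw [hcc] <;> omega)).trans_le hC₀
  have l2 : K.D₁ < d 2 := hD₁.trans_lt
    (lt_of_le_not_ge (b := d 2) (by rw [hdd] <;> omega) (by rw [hdd] <;> omega))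
  have l3 : K.C₁ < c (n - 2) := hC₁.trans_lt
    (lt_of_le_not_ge (by rw [hcc] <;> omega) (by rw [hcc] <;> omega))
  have l4 : d (n - 2) < K.D₀ :=
    (lt_of_le_not_ge (b := d i) (by rw [hdd] <;> omega) (by rw [hdd] <;> omega)).trans_le hD₀
  -- The chains realise `a_2 ≤ d_1` and `c_1 ≤ b_2`; the crossed comparabilities `a_2 ≤ b_2` and
  -- `c_1 ≤ d_1` fail.
  obtain ⟨L, hL⟩ := CrownLink.exists_of_le K (m := c 2) (M := d 2)
    (fun x => bif x then a 2 else c 1) (fun x => bif x then d 1 else b 2)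
    (by rintro (_ | _) <;> dsimp <;> [rw [hcc]; rw [hac]] <;> omega) l1 l2
    (by rintro (_ | _) <;> dsimp <;> [rw [hdb]; rw [hdd]] <;> omega)
    (by rintro (_ | _) <;> dsimp <;> [rw [hcb]; rw [had]] <;> omega)
    (by rintro (_ | _) <;> simp only [Bool.not_false, Bool.not_true, cond_true, cond_false] <;>
      [rw [hab]; apply hcd] <;> omega)
  have hlo : ∀ x : Bool, (bif x then d (n - 1) else a (n - 1)) ≤ d (n - 2) := by
    rintro (_ | _) <;> dsimp <;> [rw [had]; rw [hdd]] <;> omega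
  have hhi : ∀ x : Bool, c (n - 2) ≤ (bif x then b (n - 1) else c (n - 1)) := by
    rintro (_ | _) <;> dsimp <;> [rw [hcc]; rw [hcb]] <;> omega
  have hlh : ∀ x : Bool, (bif x then d (n - 1) else a (n - 1)) ≤
      (bif x then b (n - 1) else c (n - 1)) := by
    rintro (_ | _) <;> dsimp <;> [rw [hac]; rw [hdb]] <;> omega
  have hnlh : ∀ x : Bool, ¬ (bif x then d (n - 1) else a (n - 1)) ≤
      (bif !x then b (n - 1) else c (n - 1)) := by
    rintro (_ | _) <;> simp only [Bool.not_false, Bool.not_true, cond_true, cond_false] <;>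
      [rw [hab]; apply hdc] <;> omega
  -- At the other end the chains realise `d_{n-1} ≤ b_{n-1}` and `a_{n-1} ≤ c_{n-1}`.
  obtain ⟨L', hL'⟩ := CrownLink.exists_of_le (P := Pᵒᵈ) K.dual (m := c (n - 2)) (M := d (n - 2))
    (fun x => bif x then b (n - 1) else c (n - 1)) (fun x => bif x then d (n - 1) else a (n - 1))
    hhi l3 l4 hlo hlh hnlh
  refine ⟨K.Z, K.notMem_Z_of_lt_C₀ (L.lt_C₀ _ (hL false)), ?_, ?_, fun E hE hEd hp hq =>
    L.separates L' D hE hEd (hL false) (hL' false) hp hq⟩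
  · rw [← K.dual_Z]
    exact K.dual.notMem_Z_of_lt_C₀ (L'.lt_C₀ _ (hL' false))
  · intro x hx
    have ac : ∀ {m}, m ≤ n - 1 → 1 ≤ m → c m ≤ x → ∀ j, 1 ≤ j → j ≤ m → a j ≤ x :=
      fun h1 h2 h j h3 h4 => le_trans (by rw [hac] <;> omega) h
    have ad : ∀ {m}, m ≤ n - 1 → 1 ≤ m → d m ≤ x → ∀ j, m < j → j ≤ n → a j ≤ x :=
      fun h1 h2 h j h3 h4 => le_trans (by rw [had] <;> omega) h
    have bc : ∀ {m}, m ≤ n - 1 → 1 ≤ m → x ≤ c m → ∀ j, m < j → j ≤ n → x ≤ b j :=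
      fun h1 h2 h j h3 h4 => le_trans h (by rw [hcb] <;> omega)
    have bd : ∀ {m}, m ≤ n - 1 → 1 ≤ m → x ≤ d m → ∀ j, 1 ≤ j → j ≤ m → x ≤ b j :=
      fun h1 h2 h j h3 h4 => le_trans h (by rw [hdb] <;> omega)
    have hb := K.bounds x
    have kA : K.A ≤ x → a i ≤ x := hA.trans
    have kB : x ≤ K.B → x ≤ b i := fun h => h.trans hB
    have kC₀ : K.C₀ ≤ x → ∀ j, 1 ≤ j → j < i → a j ≤ x := fun h j h1 h2 =>
      ac (by omega) (by omega) (hC₀.trans h) j h1 (by omega)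
    have kD₀ : K.D₀ ≤ x → ∀ j, i < j → j ≤ n → a j ≤ x := fun h j h1 h2 =>
      ad (by omega) (by omega) (hD₀.trans h) j h1 (by omega)
    have kC₁ : x ≤ K.C₁ → ∀ j, i < j → j ≤ n → x ≤ b j := fun h j h1 h2 =>
      bc (by omega) (by omega) (h.trans hC₁) j h1 (by omega)
    have kD₁ : x ≤ K.D₁ → ∀ j, 1 ≤ j → j < i → x ≤ b j := fun h j h1 h2 =>
      bd (by omega) (by omega) (h.trans hD₁) j h1 (by omega)
    rcases hx with ((((hx | hx) | hx) | hx) | hx) | hx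
    · exact .inl ⟨kA (hb.1 hx).1, kC₁ (hb.1 hx).2⟩
    · exact .inr (.inl ⟨kA (hb.2.1 hx).1, kD₁ (hb.2.1 hx).2⟩)
    · exact .inr (.inr (.inr (.inr (.inl ⟨kC₀ (hb.2.2.1 hx).1, kC₁ (hb.2.2.1 hx).2⟩))))
    · exact .inr (.inr (.inl ⟨kC₀ (hb.2.2.2.1 hx).1, kB (hb.2.2.2.1 hx).2⟩))
    · exact .inr (.inr (.inr (.inr (.inr ⟨kD₀ (hb.2.2.2.2.1 hx).1, kD₁ (hb.2.2.2.2.1 hx).2⟩))))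
    · exact .inr (.inr (.inr (.inl ⟨kD₀ (hb.2.2.2.2.2 hx).1, kB (hb.2.2.2.2.2 hx).2⟩)))

theorem le_of_kelly_embedding [Finite P] {k : ℕ} (hk : 1 ≤ k)
    (D : PlanarDrawing (SimpleGraph.hasse P)) (hD : D.IsOuterplanarOn k univ) (f : Kelly n ↪o P) :
    n ≤ 4 * k + 2 := by
  classical
  by_contra! hn
  -- A total extension of `f`; the value off the Kelly family is never used.
  let F : Finset ℕ → P := fun s => if h : s ∈ kellyFamily n then f ⟨s, h⟩ else
    f ⟨{1}, singleton_mem_kellyFamily le_rfl (by omega)⟩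
  have hF : ∀ s t, s ∈ kellyFamily n → t ∈ kellyFamily n → (F s ≤ F t ↔ s ⊆ t) := by
    intro s t hs ht
    simp only [F, dif_pos hs, dif_pos ht, f.le_iff_le, Subtype.mk_le_mk]
  let a : ℕ → P := fun i => F {i}
  let b : ℕ → P := fun i => F (Finset.Icc 1 n \ {i})
  let c : ℕ → P := fun i => F (Finset.Icc 1 i)
  let d : ℕ → P := fun i => F (Finset.Icc (i + 1) n)
  have hb : ∀ i, 1 ≤ i → i ≤ n → ∀ s ∈ kellyFamily n, s ⊆ Finset.Icc 1 n →
      (F s ≤ b i ↔ i ∉ s) := by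
    intro i h1 h2 s hs hsn
    rw [hF _ _ hs (sdiff_mem_kellyFamily h1 h2)]
    exact ⟨fun h hi => by simpa using h hi, fun h x hx => by
      simp only [Finset.mem_sdiff, Finset.mem_singleton]
      exact ⟨hsn hx, fun hxi => h (hxi ▸ hx)⟩⟩
  have hcyc : ∀ i, 4 ≤ i → i + 3 ≤ n → _ := fun i hi hin =>
    exists_separating_cycle (n := n) D (a := a) (b := b) (c := c) (d := d)
    (fun i j h1 h2 h3 h4 => by
      rw [hb j h3 h4 _ (singleton_mem_kellyFamily h1 h2) (by simp [h1, h2])]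
      simp [eq_comm])
    (fun i j h1 h2 h3 h4 => by
      rw [hF _ _ (singleton_mem_kellyFamily h1 h2) (Icc_one_mem_kellyFamily h3 h4)]
      simp [h1])
    (fun i j h1 h2 h3 h4 => by
      rw [hF _ _ (singleton_mem_kellyFamily h1 h2) (Icc_succ_mem_kellyFamily h3 h4)]
      simp [h2])
    (fun i j h1 h2 h3 h4 => by
      rw [hb j h3 h4 _ (Icc_one_mem_kellyFamily h1 h2) (Finset.Icc_subset_Icc le_rfl h2.le)]
      simp [h3])
    (fun i j h1 h2 h3 h4 => by
      rw [hb j h3 h4 _ (Icc_succ_mem_kellyFamily h1 h2) (Finset.Icc_subset_Icc (by omega) le_rfl)]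
      simp [h4])
    (fun i j h1 h2 h3 h4 => by
      rw [hF _ _ (Icc_one_mem_kellyFamily h1 h2) (Icc_one_mem_kellyFamily h3 h4),
        Finset.Icc_subset_Icc_iff h1]
      simp)
    (fun i j h1 h2 h3 h4 => by
      rw [hF _ _ (Icc_succ_mem_kellyFamily h1 h2) (Icc_succ_mem_kellyFamily h3 h4),
        Finset.Icc_subset_Icc_iff h2]
      simp)
    (fun i j h1 h2 h3 h4 => by
      rw [hF _ _ (Icc_one_mem_kellyFamily h1 h2) (Icc_succ_mem_kellyFamily h3 h4),
        Finset.Icc_subset_Icc_iff h1]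
      omega)
    (fun i j h1 h2 h3 h4 => by
      rw [hF _ _ (Icc_succ_mem_kellyFamily h1 h2) (Icc_one_mem_kellyFamily h3 h4),
        Finset.Icc_subset_Icc_iff h2]
      omega) hi hin
  have hex : ∀ x : P, ∀ j, 1 ≤ j → j ≤ n → ¬ (a j ≤ x ∧ x ≤ b j) := by
    rintro x j h1 h2 ⟨h3, h4⟩
    have := (hb j h1 h2 _ (singleton_mem_kellyFamily h1 h2) (by simp [h1, h2])).1 (h3.trans h4)
    simp at this
  obtain ⟨R, hR, hball⟩ := D.exists_support_subset_closedBall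
  obtain ⟨H, hpH, hHk, E, hE, hNE, hpE, hEd⟩ :=
    D.exists_small_set_freeing hR hball k univ hD (c 1) (mem_univ _)
  obtain ⟨H', hpH', hHk', E', hE', hNE', hpE', hEd'⟩ :=
    D.exists_small_set_freeing hR hball k univ hD (c (n - 1)) (mem_univ _)
  have hhit : ∀ i, ∃ h, 4 ≤ i → i + 3 ≤ n → h ∈ H.erase (c 1) ∪ H'.erase (c (n - 1)) ∧
      KellyPosition n (fun j => a j ≤ h) (fun j => h ≤ b j) i := by
    intro i
    by_cases hi : 4 ≤ i ∧ i + 3 ≤ n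
    swap
    · exact ⟨c 1, fun h1 h2 => absurd ⟨h1, h2⟩ hi⟩
    obtain ⟨Z, hpZ, hqZ, hpos, hsep⟩ := hcyc i hi.1 hi.2
    suffices ∃ h ∈ H.erase (c 1) ∪ H'.erase (c (n - 1)), h ∈ Z by
      obtain ⟨h, h1, h2⟩ := this
      exact ⟨h, fun _ _ => ⟨h1, hpos h h2⟩⟩
    by_contra! hcon
    obtain ⟨z, hz⟩ : ((Metric.closedBall (0 : ℂ) R)ᶜ).Nonempty := by
      by_contra h
      rw [not_nonempty_iff_eq_empty, compl_empty_iff] at h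
      exact NormedSpace.unbounded_univ ℝ ℂ (h ▸ Metric.isBounded_closedBall)
    -- The two freed sets share the outside of the ball, so a cycle free of deleted vertices would
    -- fail to separate `c 1` from `c (n - 1)`.
    refine hsep (E ∪ E') (hE.union z (hNE hz) (hNE' hz) hE') ?_ (.inl hpE) (.inr hpE')
    refine Disjoint.union_left ?_ ?_
    · refine hEd.mono_right (D.support_mono fun x hx => (⟨mem_univ x, fun hxH => ?_⟩ :
        x ∈ univ \ (H : Set P)))
      exact hcon x (Finset.mem_union_left _ (Finset.mem_erase.2 ⟨fun h => hpZ (h ▸ hx), hxH⟩)) hx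
    · refine hEd'.mono_right (D.support_mono fun x hx => (⟨mem_univ x, fun hxH => ?_⟩ :
        x ∈ univ \ (H' : Set P)))
      exact hcon x (Finset.mem_union_right _ (Finset.mem_erase.2 ⟨fun h => hqZ (h ▸ hx), hxH⟩)) hx
  choose g hg using hhit
  -- At most `2(k - 1)` deleted vertices face `n - 6 ≥ 4k - 3` cycles, so some vertex is assigned to
  -- three of them.
  have hcard : (H.erase (c 1) ∪ H'.erase (c (n - 1))).card * 2 < (Finset.Icc 4 (n - 3)).card := by
    have h1 := Finset.card_union_le (H.erase (c 1)) (H'.erase (c (n - 1)))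
    rw [Finset.card_erase_of_mem hpH, Finset.card_erase_of_mem hpH'] at h1
    rw [Nat.card_Icc]
    omega
  obtain ⟨x, -, hx⟩ := Finset.exists_lt_card_fiber_of_mul_lt_card_of_maps_to
    (f := g) (fun i hi => (hg i (Finset.mem_Icc.1 hi).1
      (by have := (Finset.mem_Icc.1 hi).2; omega)).1) hcard
  obtain ⟨i, j, l, hi, hj, hl, hij, hil, hjl⟩ := Finset.two_lt_card_iff.1 hx
  have key : ∀ {i}, i ∈ (Finset.Icc 4 (n - 3)).filter (g · = x) →
      4 ≤ i ∧ i + 3 ≤ n ∧ KellyPosition n (fun j => a j ≤ x) (fun j => x ≤ b j) i := by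
    intro i hi
    rw [Finset.mem_filter, Finset.mem_Icc] at hi
    have h2 : i + 3 ≤ n := by omega
    exact ⟨hi.1.1, h2, hi.2 ▸ (hg i hi.1.1 h2).2⟩
  have three : ∀ {i j l}, i < j → j < l → i ∈ (Finset.Icc 4 (n - 3)).filter (g · = x) →
      j ∈ (Finset.Icc 4 (n - 3)).filter (g · = x) →
      l ∈ (Finset.Icc 4 (n - 3)).filter (g · = x) → False := by
    intro i j l hij hjl hi hj hl
    have := (key hi).1
    have := (key hl).2.1
    exact KellyPosition.false_of_three (hex x) (by omega) hij hjl (by omega) (key hi).2.2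
      (key hj).2.2 (key hl).2.2
  rcases lt_or_gt_of_ne hij with h1 | h1 <;> rcases lt_or_gt_of_ne hil with h2 | h2 <;>
    rcases lt_or_gt_of_ne hjl with h3 | h3
  · exact three h1 h3 hi hj hl
  · exact three h2 h3 hi hl hj
  · omega
  · exact three h2 h1 hl hi hj
  · exact three h1 h2 hj hi hl
  · omega
  · exact three h3 h2 hj hl hi
  · exact three h3 h1 hl hj hi

end Kelly

end

theorem lemma3p4 (k : ℕ) (hk : 1 ≤ k) (P : Type*) [PartialOrder P] [Finite P]
    (hP : IsKOuterplanar k (SimpleGraph.hasse P)) :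
    kappa P ≤ 4 * k + 2 := by
  obtain ⟨D, hD⟩ := hP
  rcases (isGreatest_kappa P).1 with h | ⟨-, ⟨f⟩⟩
  · omega
  · exact le_of_kelly_embedding hk D hD f
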